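/- Let $M$ be a nonempty topological space, and let $r:M\times M\to[0,\pi/2]$, $\theta:M\times M\to[0,\pi]$ be such that: $r$ is a pseudo-metric; $\theta$ is symmetric and vanishes on the diagonal; $r(x,y)=\theta(x,y)=0$ implies $x=y$; the sets $\{y: r(x,y)<\varepsilon,\ \theta(x,y)<\varepsilon\}$, $\varepsilon>0$, form a neighbourhood basis at each $x\in M$; $\theta$ is continuous on $\{(x,y): r(x,y)<\pi/2\}$; and every sequence that is Cauchy for both $r$ and $\theta$ converges, for both, to some point of $M$. (All of this holds, for the topology induced by $r$ and $\theta$, if $r<\pi/2$ and $\theta<\pi$ are two pseudo-metrics that jointly separate points and are jointly complete.) Let $\mu$ be a $\sigma$-finite Borel measure on $M$ that is positive on nonempty open sets, and suppose that $p_t(x,y)=p(t,r(x,y),\theta(x,y))$, $t>0$, with $$p(t,r,\theta)=\sum_{n\in\mathbb Z}\sum_{k\ge 0}(2k+|n|+1)\,e^{-(4k(k+|n|+1)+2|n|)t}\,e^{in\theta}(\cos r)^{|n|}P_k^{0,|n|}(\cos 2r),$$ $$P_k^{0,|n|}(x)=\frac{(-1)^k}{2^kk!(1+x)^{|n|}}\frac{d^k}{dx^k}\Big((1+x)^{|n|}(1-x^2)^k\Big)$$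 (the terms with $n\neq0$ being $0$ at $r=\pi/2$), is a heat kernel on $(M,\mu)$: it is measurable on $M\times M$ and, for all $s,t>0$ and $\mu$-almost all $x,y$, one has $p_t(x,y)\ge0$, $p_t(x,y)=p_t(y,x)$, $\int_M p_t(x,y)\,d\mu(y)=1$, $p_{s+t}(x,y)=\int_M p_s(x,z)p_t(z,y)\,d\mu(z)$, and $P_tf:=\int_M p_t(\cdot,y)f(y)\,d\mu(y)\to f$ in $L^2(\mu)$ as $t\to0^+$ for all $f\in L^2(\mu)$. Let $L$ be the generator of $(P_t)$, $Lf=\lim_{t\to0^+}(P_tf-f)/t$ in $L^2(\mu)$, and let $E_{0,1}=\ker(L+2)\subset L^2(M,\mu)$. Put $\delta(x,y)=\arccos(\cos r(x,y)\cos\theta(x,y))$. Then $\delta$ is a metric on $M$ and $\dim E_{0,1}=4$. There are points $x_1,\dots,x_4\in M$ and continuous functions $\varphi_1,\dots,\varphi_4$ on $M$ forming a basis of $E_{0,1}$ with $\varphi_i(x_j)=1$ if $i=j$ and $0$ otherwise. For every such choice, the symmetric bilinear form $\beta_1(\zeta,\zeta')=\sum_{i,j=1}^4\cos\theta(x_i,x_j)\cos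 r(x_i,x_j)\,\zeta_i\zeta'_j$ on $\mathbb R^4$ is positive definite, and, writing $Q(\zeta)=\beta_1(\zeta,\zeta)$, the map $\Phi=(\varphi_1,\dots,\varphi_4):M\to\mathbb R^4$ is an isometry from $(M,\delta)$ onto the round unit sphere $\mathcal S^3=\{\zeta\in\mathbb R^4: Q(\zeta)=1\}$ with its angular metric $d_{\mathcal S^3}(u,v)=2\arcsin\big(\tfrac12\sqrt{Q(u-v)}\big)$: it maps $M$ bijectively onto $\mathcal S^3$, and $d_{\mathcal S^3}(\Phi(x),\Phi(y))=\delta(x,y)$ for all $x,y\in M$. -/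

import Mathlib

open MeasureTheory Filter Topology

namespace HopfHeat

noncomputable section

/-! ### Abstract heat kernels, their generators and eigenspaces -/

/-- `p t x y` (`t > 0`) is a conservative, symmetric heat kernel on the measure space `(M, μ)`. -/
structure IsHeatKernel {M : Type*} [MeasurableSpace M] (μ : Measure M)
    (p : ℝ → M → M → ℝ) : Prop where
  measurable : ∀ t, 0 < t → Measurable (Function.uncurry (p t))
  nonneg : ∀ t, 0 < t → ∀ᵐ z ∂(μ.prod μ), 0 ≤ p t z.1 z.2
  symm : ∀ t, 0 < t → ∀ᵐ z ∂(μ.prod μ), p t z.1 z.2 = p t z.2 z.1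
  conservative : ∀ t, 0 < t → ∀ᵐ x ∂μ,
    Integrable (fun y => p t x y) μ ∧ ∫ y, p t x y ∂μ = 1
  semigroup : ∀ s t, 0 < s → 0 < t → ∀ᵐ z ∂(μ.prod μ),
    Integrable (fun w => p s z.1 w * p t w z.2) μ ∧
      p (s + t) z.1 z.2 = ∫ w, p s z.1 w * p t w z.2 ∂μ
  approx_id : ∀ f : M → ℝ, MemLp f 2 μ →
    Tendsto (fun t => eLpNorm (fun x => (∫ y, p t x y * f y ∂μ) - f x) 2 μ) (𝓝[>] 0) (𝓝 0)

/-- The operator `P_t f (x) = ∫ p_t(x, y) f(y) dμ(y)`. -/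
def heatOp {M : Type*} [MeasurableSpace M] (μ : Measure M) (p : ℝ → M → M → ℝ)
    (t : ℝ) (f : M → ℝ) (x : M) : ℝ :=
  ∫ y, p t x y * f y ∂μ

/-- `f` lies in the domain of the infinitesimal generator `L` of `(P_t)` and `L f = g`:
each `P_t f` is a well-defined element of `L²(μ)` and `(P_t f - f) / t → g` in `L²(μ)`
as `t → 0+`. -/
structure IsGenerator {M : Type*} [MeasurableSpace M] (μ : Measure M) (p : ℝ → M → M → ℝ)
    (f g : Lp ℝ 2 μ) : Prop where
  integrable : ∀ t, 0 < t → ∀ᵐ x ∂μ, Integrable (fun y => p t x y * f y) μ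
  memLp : ∀ t, 0 < t → MemLp (heatOp μ p t f) 2 μ
  tendsto : Tendsto (fun t => eLpNorm (fun x => (heatOp μ p t f x - f x) / t - g x) 2 μ)
    (𝓝[>] 0) (𝓝 0)

section helpers

variable {M : Type*} [MeasurableSpace M] {μ : Measure M} {p : ℝ → M → M → ℝ}

theorem heatOp_congr {f g : M → ℝ} (h : f =ᵐ[μ] g) (t : ℝ) :
    heatOp μ p t f = heatOp μ p t g := by
  funext x
  refine integral_congr_ae ?_
  filter_upwards [h] with y hy
  rw [hy]

theorem IsGenerator.zero : IsGenerator μ p 0 0 := by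
  have h0 : ((0 : Lp ℝ 2 μ) : M → ℝ) =ᵐ[μ] 0 := Lp.coeFn_zero ℝ 2 μ
  have hP : ∀ t, heatOp μ p t (0 : Lp ℝ 2 μ) = 0 := by
    intro t
    rw [heatOp_congr h0]
    funext x
    simp [heatOp]
  refine ⟨fun t _ => ?_, fun t _ => ?_, ?_⟩
  · refine Eventually.of_forall fun x => ?_
    refine (integrable_zero M ℝ μ).congr ?_
    filter_upwards [h0] with y hy
    simp only [hy, Pi.zero_apply, mul_zero]
  · rw [hP]
    exact MemLp.zero
  · refine tendsto_const_nhds.congr fun t => ?_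
    symm
    rw [← eLpNorm_zero (p := 2) (μ := μ) (α := M) (ε := ℝ)]
    refine eLpNorm_congr_ae ?_
    filter_upwards [h0] with x hx
    simp only [hP, hx, Pi.zero_apply, sub_zero, zero_div]

theorem IsGenerator.add {f g f' g' : Lp ℝ 2 μ} (h : IsGenerator μ p f g)
    (h' : IsGenerator μ p f' g') : IsGenerator μ p (f + f') (g + g') := by
  have hf := Lp.coeFn_add f f'
  have hg := Lp.coeFn_add g g'
  have hP : ∀ t, 0 < t →
      heatOp μ p t (f + f' : Lp ℝ 2 μ) =ᵐ[μ] heatOp μ p t f + heatOp μ p t f' := by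
    intro t ht
    rw [heatOp_congr hf]
    filter_upwards [h.integrable t ht, h'.integrable t ht] with x hx hx'
    simp only [heatOp, Pi.add_apply, mul_add]
    exact integral_add hx hx'
  refine ⟨fun t ht => ?_, fun t ht => ?_, ?_⟩
  · filter_upwards [h.integrable t ht, h'.integrable t ht] with x hx hx'
    refine (hx.add hx').congr ?_
    filter_upwards [hf] with y hy
    simp only [hy, Pi.add_apply, mul_add]
  · exact ((h.memLp t ht).add (h'.memLp t ht)).ae_eq (hP t ht).symm
  · have hs := h.tendsto.add h'.tendsto
    rw [add_zero] at hs
    refine tendsto_of_tendsto_of_tendsto_of_le_of_le' tendsto_const_nhds hs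
      (Eventually.of_forall fun _ => zero_le) ?_
    filter_upwards [self_mem_nhdsWithin] with t ht
    have m : ∀ {f g : Lp ℝ 2 μ}, IsGenerator μ p f g → AEStronglyMeasurable
        (fun x => (heatOp μ p t f x - f x) / t - g x) μ := by
      intro f g h
      have e1 := (h.memLp t ht).aestronglyMeasurable
      have e2 := (e1.sub (Lp.aestronglyMeasurable f)).const_mul t⁻¹
      refine (e2.sub (Lp.aestronglyMeasurable g)).congr (Eventually.of_forall fun x => ?_)
      simp [div_eq_inv_mul]
    refine le_trans (le_of_eq ?_) (eLpNorm_add_le (m h) (m h') (by norm_num))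
    refine eLpNorm_congr_ae ?_
    filter_upwards [hf, hg, hP t ht] with x h1 h2 h3
    simp only [h1, h2, h3, Pi.add_apply]
    ring

theorem IsGenerator.smul (c : ℝ) {f g : Lp ℝ 2 μ} (h : IsGenerator μ p f g) :
    IsGenerator μ p (c • f) (c • g) := by
  have hf := Lp.coeFn_smul c f
  have hg := Lp.coeFn_smul c g
  have hP : ∀ t, heatOp μ p t (c • f : Lp ℝ 2 μ) = c • heatOp μ p t f := by
    intro t
    rw [heatOp_congr hf]
    funext x
    simp only [heatOp, Pi.smul_apply, smul_eq_mul]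
    rw [← integral_const_mul]
    congr 1
    funext y
    ring
  refine ⟨fun t ht => ?_, fun t ht => ?_, ?_⟩
  · filter_upwards [h.integrable t ht] with x hx
    refine (hx.const_mul c).congr ?_
    filter_upwards [hf] with y hy
    simp only [hy, Pi.smul_apply, smul_eq_mul]
    ring
  · rw [hP]
    exact (h.memLp t ht).const_smul c
  · have hs := ENNReal.Tendsto.const_mul (a := ‖c‖ₑ) h.tendsto (Or.inr enorm_ne_top)
    rw [mul_zero] at hs
    refine hs.congr fun t => ?_
    rw [← eLpNorm_const_smul]
    refine eLpNorm_congr_ae ?_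
    filter_upwards [hf, hg] with x h1 h2
    simp only [h1, h2, hP, Pi.smul_apply, smul_eq_mul]
    ring

end helpers

/-- The eigenspace `Ker (L - lam Id)` in `L²(M, μ)` of the generator `L` of `(P_t)`. -/
def eigenspace {M : Type*} [MeasurableSpace M] (μ : Measure M) (p : ℝ → M → M → ℝ) (lam : ℝ) :
    Submodule ℝ (Lp ℝ 2 μ) where
  carrier := {f | IsGenerator μ p f (lam • f)}
  zero_mem' := by
    have h := IsGenerator.zero (μ := μ) (p := p)
    simpa using h
  add_mem' := by
    intro f g hf hg
    have h := hf.add hg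
    simpa using h
  smul_mem' := by
    intro c f hf
    have h := IsGenerator.smul c hf
    rw [smul_comm] at h
    exact h

/-! ### The explicit kernel -/

/-- The Jacobi polynomial `P_k^{0,n}`, by Rodrigues' formula. (At `x = -1`, `n > 0`, the formula
does not make sense; below it is then multiplied by `0`.) -/
def jacobi (k n : ℕ) (x : ℝ) : ℝ :=
  (-1) ^ k / (2 ^ k * (k.factorial : ℝ) * (1 + x) ^ n) *
    ((Polynomial.derivative^[k])
      ((1 + Polynomial.X) ^ n * (1 - Polynomial.X ^ 2) ^ k : Polynomial ℝ)).eval x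

/-- `λ_{k,n} = -(4k(k + n + 1) + 2n)`. -/
def lam (k n : ℕ) : ℝ := -(4 * (k : ℝ) * ((k : ℝ) + n + 1) + 2 * n)

/-- The function `p(t, r, θ)`, as a complex series over `n ∈ ℤ`, `k ∈ ℕ`. -/
def kernelSeries (t r θ : ℝ) : ℂ :=
  ∑' q : ℤ × ℕ,
    (((2 * (q.2 : ℝ) + (q.1.natAbs : ℝ) + 1) * Real.exp (lam q.2 q.1.natAbs * t) : ℝ) : ℂ) *
      Complex.exp (Complex.I * (q.1 : ℂ) * (θ : ℂ)) *
      ((Real.cos r ^ q.1.natAbs * jacobi q.2 q.1.natAbs (Real.cos (2 * r)) : ℝ) : ℂ)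

/-- `p_t(x, y) = p(t, r(x, y), θ(x, y))`; the series is real, its terms for `n` and `-n` being
complex conjugates. -/
def kernel {M : Type*} (r θ : M → M → ℝ) (t : ℝ) (x y : M) : ℝ :=
  (kernelSeries t (r x y) (θ x y)).re

/-! ### The spaces under consideration -/

/-- `u` is a Cauchy sequence for `d`. -/
def IsCauchyFor {M : Type*} (d : M → M → ℝ) (u : ℕ → M) : Prop :=
  ∀ ε, 0 < ε → ∃ N, ∀ m, N ≤ m → ∀ n, N ≤ n → d (u m) (u n) < ε

/-- `M` carries a pseudo-metric `r ≤ π/2` and a symmetric function `0 ≤ θ ≤ π`, jointly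
separating points and jointly complete, which induce the topology of `M`, and
`p_t(x,y) = p(t, r(x,y), θ(x,y))` is a heat kernel for `μ`. No triangle inequality is required
of `θ`, only continuity off `{r = π/2}`; a pseudo-metric `θ` has this property. -/
structure IsHopfHeatSpace {M : Type*} [TopologicalSpace M] [MeasurableSpace M]
    (r θ : M → M → ℝ) (μ : Measure M) : Prop where
  r_nonneg : ∀ x y, 0 ≤ r x y
  r_le : ∀ x y, r x y ≤ Real.pi / 2
  r_self : ∀ x, r x x = 0
  r_symm : ∀ x y, r x y = r y x
  r_triangle : ∀ x y z, r x z ≤ r x y + r y z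
  θ_nonneg : ∀ x y, 0 ≤ θ x y
  θ_le : ∀ x y, θ x y ≤ Real.pi
  θ_self : ∀ x, θ x x = 0
  θ_symm : ∀ x y, θ x y = θ y x
  separated : ∀ x y, r x y = 0 → θ x y = 0 → x = y
  nhds_basis : ∀ x, (𝓝 x).HasBasis (fun ε : ℝ => 0 < ε) (fun ε => {y | r x y < ε ∧ θ x y < ε})
  θ_continuous : ContinuousOn (Function.uncurry θ) {z | r z.1 z.2 < Real.pi / 2}
  complete : ∀ u : ℕ → M, IsCauchyFor r u → IsCauchyFor θ u →
    ∃ x, Tendsto (fun n => r (u n) x) atTop (𝓝 0) ∧ Tendsto (fun n => θ (u n) x) atTop (𝓝 0)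
  heatKernel : IsHeatKernel μ (kernel r θ)

/-- `δ(x, y) = arccos (cos r(x, y) cos θ(x, y))`. -/
def delta {M : Type*} (r θ : M → M → ℝ) (x y : M) : ℝ :=
  Real.arccos (Real.cos (r x y) * Real.cos (θ x y))

/-- `d` is a metric on `X`. -/
structure IsMetric {X : Type*} (d : X → X → ℝ) : Prop where
  nonneg : ∀ x y, 0 ≤ d x y
  eq_zero_iff : ∀ x y, d x y = 0 ↔ x = y
  symm : ∀ x y, d x y = d y x
  triangle : ∀ x y z, d x z ≤ d x y + d y z

/-- The eigenspace `E_{0,1} = Ker (L - λ_{0,1} Id)`, `λ_{0,1} = -2`. -/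
def E01 {M : Type*} [MeasurableSpace M] (r θ : M → M → ℝ) (μ : Measure M) :
    Submodule ℝ (Lp ℝ 2 μ) :=
  eigenspace μ (kernel r θ) (lam 0 1)

/-- `φ₁, …, φ₄` are continuous eigenfunctions forming a basis of `E_{0,1}`, and the evaluations
at the points `x₁, …, x₄` form the dual basis. -/
structure IsDualEigenbasis {M : Type*} [TopologicalSpace M] [MeasurableSpace M]
    (r θ : M → M → ℝ) (μ : Measure M) (x : Fin 4 → M) (φ : Fin 4 → M → ℝ) : Prop where
  continuous : ∀ i, Continuous (φ i)
  basis : ∃ b : Module.Basis (Fin 4) ℝ (E01 r θ μ), ∀ i, ((b i : Lp ℝ 2 μ) : M → ℝ) =ᵐ[μ] φ i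
  dual : ∀ i j, φ i (x j) = if i = j then 1 else 0

/-- `a_{ij} = cos θ(x_i, x_j) cos r(x_i, x_j)`. -/
def gram {M : Type*} (r θ : M → M → ℝ) (x : Fin 4 → M) : Matrix (Fin 4) (Fin 4) ℝ :=
  Matrix.of fun i j => Real.cos (θ (x i) (x j)) * Real.cos (r (x i) (x j))

/-- The quadratic form `Q(ζ) = ∑ a_{ij} ζ_i ζ_j` on `ℝ⁴`. -/
def quad (a : Matrix (Fin 4) (Fin 4) ℝ) (ζ : Fin 4 → ℝ) : ℝ :=
  ∑ i, ∑ j, a i j * ζ i * ζ j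

/-- The unit sphere of `(ℝ⁴, Q)`. -/
def sphere3 (a : Matrix (Fin 4) (Fin 4) ℝ) : Set (Fin 4 → ℝ) := {ζ | quad a ζ = 1}

/-- The angular distance `2 arcsin (√Q(u - v) / 2)` on the unit sphere of `(ℝ⁴, Q)`. -/
def sphereDist (a : Matrix (Fin 4) (Fin 4) ℝ) (u v : Fin 4 → ℝ) : ℝ :=
  2 * Real.arcsin (Real.sqrt (quad a (u - v)) / 2)

end

end HopfHeat

/-!
The kernel is regrouped by eigenvalues, `p_t = ∑_L e^{-2Lt} f_L`, where each `f_L` is a finite sum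
of the functions `cos(nθ) (cos r)^{|n|} P_k^{0,|n|}(cos 2r)`. These are matrix coefficients of
`SU(2)` and hence bounded by `1` (`abs_zern_le_one`), so that all series converge absolutely and
uniformly in the space variables (`hasSum_kernelSeries`). A Dirichlet series determines its
coefficients (`dirichlet_unique`); applied to the conservation and semigroup laws this shows that
`μ` is a probability measure, that `∫ f_L(x, ·) dμ = 0` for `L ≠ 0`, and that
`∫ f_L(x, ·) f_{L'}(z, ·) dμ = δ_{LL'} f_L(x, z)`, first almost everywhere and then, by
continuity, at every point (`integral_layerKernel_mul_layerKernel`).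

The kernel `f_1 = 4 cos r cos θ` is the reproducing kernel of `E_{0,1}`: the class of `f_1(x, ·)`
is an eigenfunction (`evalVec_mem`), and every eigenfunction `u` has the continuous representative
`x ↦ ⟨f_1(x, ·), u⟩` (`coeFn_eq_inner_evalVec`), for it is orthogonal to `f_L(x, ·)`, `L ≠ 1`. As
`‖f_1(x, ·)‖² = f_1(x, x) = 4` at every point and `μ` has mass one, the sum of the squares of an
orthonormal basis integrates to `4`, which gives the dimension (`finrank_E01`). So
`X : x ↦ ½ f_1(x, ·)` maps `M` into the unit sphere of the Euclidean space `E_{0,1}` of dimension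
four, the inner product of the images of `x` and `y` being `cos r cos θ`; hence `δ` is the angle
between the images, a metric. In terms of points `x_i` and a basis dual to the evaluations at
them, this map becomes `Φ` and the norm becomes the Gram form `β_1`.

It remains to see that the image is the whole sphere. On the sphere `S³` itself the complex number
`cos r e^{iθ}`, built from a fixed point and a uniformly distributed one, is uniformly distributed
in the unit disk. The same moments are forced on `M`: the integrals of `f_L(x, ·)` and of
`f_L(x, ·) f_{L'}(x, ·)` are known, they agree with those over the disk, and an induction on the
degree shows that the functions `f_L` and their products span all the trigonometric polynomials in
question (`trigDeg_le_of_layerFun_mem`). Thus `∫ ⟨X(x), X(y)⟩^N dμ(y)` is, for every `x ∈ M`, the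
`N`-th moment of a coordinate on the uniform sphere (`integral_pow_eq_diskMoment`). If `T` and `S`
are the tensors of the moments of degree `N` of `X` and of the uniform sphere, this yields
`⟨T, T⟩ = ⟨T, S⟩ = ⟨S, S⟩`, whence `T = S`, and the identity extends from the points `X(x)` to all
unit vectors `a` (`integral_inner_pow_eq_diskMoment`). The essential supremum of `⟨a, X⟩` can be
read off from its moments and is therefore `1`, as for `a = X(x)` (`exists_inner_gt`). So the
image is dense in the sphere, and it is closed because `M` is complete (`exists_evalE01_eq`).
-/

namespace HopfHeat

/-! ### The radial functions of the kernel -/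

/-- The polynomial `R_{k,n}` of degree `k` with `P_k^{0,n}(2x - 1) = R_{k,n}(x)`, written as the
sum that Leibniz' rule produces from Rodrigues' formula. -/
noncomputable def radialPoly (k n : ℕ) : Polynomial ℝ :=
  ∑ i ∈ Finset.range (k + 1), Polynomial.C ((-1) ^ i * (k.choose i : ℝ) * ((n + k).choose i : ℝ)) *
    (Polynomial.X ^ (k - i) * (1 - Polynomial.X) ^ i)

/-- The radial function `c ^ n R_{k,n}(c²)`, equal to `(cos r)^n P_k^{0,n}(cos 2r)` at
`c = cos r`. It is a Zernike polynomial. Unlike `jacobi`, it is given by a polynomial formula that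
makes sense at `c = 0` too. -/
noncomputable def zern (k n : ℕ) (c : ℝ) : ℝ := c ^ n * (radialPoly k n).eval (c ^ 2)

theorem eval_radialPoly (k n : ℕ) (x : ℝ) : (radialPoly k n).eval x =
    ∑ i ∈ Finset.range (k + 1), (-1) ^ i * (k.choose i : ℝ) * ((n + k).choose i : ℝ) *
      (x ^ (k - i) * (1 - x) ^ i) := by
  simp [radialPoly, Polynomial.eval_finsetSum]

theorem zern_one (k n : ℕ) : zern k n 1 = 1 := by
  rw [zern, eval_radialPoly, Finset.sum_eq_single 0]
  · simp
  · intro i _ hi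
    simp [hi]
  · simp

theorem zern_zero_left (n : ℕ) (c : ℝ) : zern 0 n c = c ^ n := by
  simp [zern, eval_radialPoly]

theorem natDegree_radialPoly_le (k n : ℕ) : (radialPoly k n).natDegree ≤ k := by
  refine Polynomial.natDegree_sum_le_of_forall_le _ _ fun i hi => ?_
  have hi' : i ≤ k := by simpa [Nat.lt_succ_iff] using hi
  refine (Polynomial.natDegree_C_mul_le _ _).trans ?_
  refine Polynomial.natDegree_mul_le.trans ?_
  have h1 : ((1 - Polynomial.X : Polynomial ℝ) ^ i).natDegree ≤ i := by
    refine Polynomial.natDegree_pow_le.trans ?_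
    have : (1 - Polynomial.X : Polynomial ℝ).natDegree ≤ 1 :=
      (Polynomial.natDegree_sub_le _ _).trans (by simp)
    nlinarith
  rw [Polynomial.natDegree_X_pow]
  omega

/-- The leading coefficient, by Vandermonde's identity. -/
theorem coeff_radialPoly (k n : ℕ) : (radialPoly k n).coeff k = ((n + 2 * k).choose k : ℝ) := by
  rw [radialPoly, Polynomial.finsetSum_coeff]
  have h : ∀ i ∈ Finset.range (k + 1), (Polynomial.C ((-1) ^ i * (k.choose i : ℝ) *
      ((n + k).choose i : ℝ)) * (Polynomial.X ^ (k - i) * (1 - Polynomial.X) ^ i)).coeff k =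
      (((k.choose (k - i)) * ((n + k).choose i) : ℕ) : ℝ) := by
    intro i hi
    have hi' : i ≤ k := by simpa [Nat.lt_succ_iff] using hi
    rw [Polynomial.coeff_C_mul]
    have hk := Polynomial.coeff_X_pow_mul ((1 - Polynomial.X : Polynomial ℝ) ^ i) (k - i) i
    rw [show i + (k - i) = k by omega] at hk
    rw [hk]
    have : (1 - Polynomial.X : Polynomial ℝ) =
        Polynomial.C (-1) * (Polynomial.X + Polynomial.C (-1)) := by simp; ring
    rw [this, mul_pow, ← Polynomial.C_pow, Polynomial.coeff_C_mul, Polynomial.coeff_X_add_C_pow]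
    rw [Nat.choose_symm hi']
    push_cast
    have h2 : ((-1 : ℝ) ^ i) * (-1) ^ i = 1 := by rw [← mul_pow]; simp
    simp only [Nat.sub_self, pow_zero, Nat.choose_self, Nat.cast_one, mul_one]
    linear_combination ((k.choose i : ℝ) * ((n + k).choose i : ℝ)) * h2
  rw [Finset.sum_congr rfl h, ← Nat.cast_sum, show n + 2 * k = (n + k) + k by ring,
    Nat.add_choose_eq, Finset.Nat.sum_antidiagonal_eq_sum_range_succ_mk]
  congr 1
  exact Finset.sum_congr rfl fun i _ => mul_comm _ _

/-- At `cos r = 0` and `n > 0` both sides vanish, whatever the value of `jacobi`. -/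
theorem cos_pow_mul_jacobi (k n : ℕ) (r : ℝ) :
    Real.cos r ^ n * jacobi k n (Real.cos (2 * r)) = zern k n (Real.cos r) := by
  rw [Real.cos_two_mul]
  set c := Real.cos r
  by_cases hc : n ≠ 0 ∧ c = 0
  · simp [zern, hc.1, hc.2]
  have hcn : c ^ n ≠ 0 := by
    rw [not_and_or, not_not] at hc
    rcases hc with rfl | h
    · simp
    · exact pow_ne_zero _ h
  rw [zern]
  congr 1
  rw [jacobi, eval_radialPoly]
  have hp : ((1 + Polynomial.X) ^ n * (1 - Polynomial.X ^ 2) ^ k : Polynomial ℝ) =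
      Polynomial.C ((-1) ^ k) *
        ((Polynomial.X - Polynomial.C 1) ^ k * (Polynomial.X + Polynomial.C 1) ^ (n + k)) := by
    have : (1 - Polynomial.X ^ 2 : Polynomial ℝ) =
      Polynomial.C (-1) * ((Polynomial.X - Polynomial.C 1) * (Polynomial.X + Polynomial.C 1)) := by
      simp; ring
    rw [this, mul_pow, mul_pow, Polynomial.C_pow, Polynomial.C_1]
    ring
  rw [hp, Polynomial.iterate_derivative_C_mul, Polynomial.iterate_derivative_mul]
  simp only [Polynomial.iterate_derivative_X_sub_pow, Polynomial.iterate_derivative_X_add_pow,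
    Polynomial.eval_mul, Polynomial.eval_C, Polynomial.eval_finsetSum, Finset.mul_sum]
  refine Finset.sum_congr rfl fun i hi => ?_
  have hi' : i ≤ k := by simpa [Nat.lt_succ_iff] using hi
  have h1 : ((k.descFactorial (k - i) : ℕ) : ℝ) = k.factorial / i.factorial := by
    rw [eq_div_iff (by positivity)]
    have := Nat.factorial_mul_descFactorial (Nat.sub_le k i)
    rw [Nat.sub_sub_self hi'] at this
    rw [← this]; push_cast; ring
  have h2 : (((n + k).descFactorial i : ℕ) : ℝ) = i.factorial * (n + k).choose i := by
    rw [Nat.descFactorial_eq_factorial_mul_choose]; push_cast; ring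
  simp only [nsmul_eq_mul, Polynomial.eval_mul, Polynomial.eval_natCast, Polynomial.eval_pow,
    Polynomial.eval_sub, Polynomial.eval_add, Polynomial.eval_X, Polynomial.eval_C, h1, h2]
  rw [Nat.sub_sub_self hi', show 2 * c ^ 2 - 1 - 1 = (-1) * (2 * (1 - c ^ 2)) by ring,
    show 2 * c ^ 2 - 1 + 1 = 2 * c ^ 2 by ring, show 1 + (2 * c ^ 2 - 1) = 2 * c ^ 2 by ring,
    show n + k - i = n + (k - i) by omega]
  have h3 : (2 : ℝ) ^ k = 2 ^ (k - i) * 2 ^ i := by rw [← pow_add]; congr 1; omega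
  have h4 : ((-1 : ℝ) ^ k) * (-1) ^ k = 1 := by rw [← mul_pow]; simp
  rw [h3]
  simp only [mul_pow, pow_add]
  have hc2 : (c ^ 2) ^ n ≠ 0 := by rw [← pow_mul, mul_comm, pow_mul]; exact pow_ne_zero _ hcn
  field_simp
  linear_combination
    ((c ^ 2) ^ (k - i) * (k.choose i : ℝ) * (n + k).choose i * (1 - c ^ 2) ^ i) * h4

/-! ### Bounds and orthogonality for the radial functions -/

/-- For `a + b = 1`, the product `a ^ k b ^ m` is greatest at `a = k / (k + m)`. -/
theorem pow_mul_pow_le_of_add_eq_one {a b : ℝ} (ha : 0 ≤ a) (hb : 0 ≤ b) (hab : a + b = 1)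
    {k m : ℕ} (hk : 0 < k) (hm : 0 < m) :
    a ^ k * b ^ m ≤ ((k : ℝ) / (k + m)) ^ k * ((m : ℝ) / (k + m)) ^ m := by
  have hk' : (0 : ℝ) < k := by exact_mod_cast hk
  have hm' : (0 : ℝ) < m := by exact_mod_cast hm
  set p : ℝ := k / (k + m) with hp
  set q : ℝ := m / (k + m) with hq
  have hp0 : 0 < p := by positivity
  have hq0 : 0 < q := by positivity
  have hpq : p + q = 1 := by rw [hp, hq]; field_simp
  have h := Real.geom_mean_le_arith_mean2_weighted hp0.le hq0.le (div_nonneg ha hp0.le)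
    (div_nonneg hb hq0.le) hpq
  rw [mul_div_cancel₀ _ hp0.ne', mul_div_cancel₀ _ hq0.ne', hab] at h
  have h2 : ((a / p) ^ p * (b / q) ^ q) ^ (k + m) = (a / p) ^ k * (b / q) ^ m := by
    rw [mul_pow, ← Real.rpow_natCast, ← Real.rpow_natCast, ← Real.rpow_mul (by positivity),
      ← Real.rpow_mul (by positivity)]
    have e1 : p * ((k + m : ℕ) : ℝ) = k := by rw [hp]; push_cast; field_simp
    have e2 : q * ((k + m : ℕ) : ℝ) = m := by rw [hq]; push_cast; field_simp
    rw [e1, e2, Real.rpow_natCast, Real.rpow_natCast]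
  have h3 : (a / p) ^ k * (b / q) ^ m ≤ 1 := by
    rw [← h2]
    exact pow_le_one₀ (by positivity) h
  rw [div_pow a p, div_pow b q, div_mul_div_comm, div_le_one (by positivity)] at h3
  exact h3

/-- Cauchy's estimate for the coefficients of a polynomial. -/
theorem norm_coeff_le_of_norm_eval_le (P : Polynomial ℂ) (k : ℕ) {R C : ℝ} (hR : 0 < R)
    (hC : ∀ z : ℂ, ‖z‖ = R → ‖P.eval z‖ ≤ C) : ‖P.coeff k‖ ≤ C / R ^ k := by
  have h := Complex.norm_iteratedDeriv_le_of_forall_mem_sphere_norm_le (c := 0)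
    (f := fun z => P.eval z) k hR
    P.differentiable.diffContOnCl (fun z hz => hC z (by simpa using hz))
  have h2 : ∀ (j : ℕ), deriv^[j] (fun z => P.eval z) =
      fun z => (Polynomial.derivative^[j] P).eval z := by
    intro j
    induction j with
    | zero => simp
    | succ j ih =>
      rw [Function.iterate_succ_apply', ih, Function.iterate_succ_apply']
      funext z
      exact Polynomial.deriv _
  rw [iteratedDeriv_eq_iterate, h2] at h
  have h3 : (Polynomial.derivative^[k] P).eval 0 = k.factorial * P.coeff k := by
    rw [← Polynomial.coeff_zero_eq_eval_zero, Polynomial.coeff_iterate_derivative]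
    simp [Nat.descFactorial_self]
  simp only [h3, norm_mul, Complex.norm_natCast] at h
  rw [mul_div_assoc] at h
  exact le_of_mul_le_mul_left h (by positivity)

/-- The radial function is a matrix coefficient, in the basis of monomials, of the action of the
rotation with matrix `(c, -s; s, c)` on binary forms of degree `n + 2k`. -/
theorem zern_eq_coeff (k n : ℕ) {c s : ℝ} (hcs : c ^ 2 + s ^ 2 = 1) :
    ((zern k n c : ℝ) : ℂ) =
      (((Polynomial.C (c : ℂ) * Polynomial.X + Polynomial.C (-s : ℂ)) ^ k *
        (Polynomial.C (s : ℂ) * Polynomial.X + Polynomial.C (c : ℂ)) ^ (n + k)).coeff k) := by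
  have key : ∀ (a b : ℂ) (m i : ℕ), ((Polynomial.C a * Polynomial.X + Polynomial.C b) ^ m).coeff i =
      a ^ i * b ^ (m - i) * m.choose i := by
    intro a b m i
    rw [add_pow, Polynomial.finsetSum_coeff]
    have : ∀ j ∈ Finset.range (m + 1), ((Polynomial.C a * Polynomial.X) ^ j *
        Polynomial.C b ^ (m - j) * (m.choose j : Polynomial ℂ)).coeff i =
        if i = j then a ^ i * b ^ (m - i) * m.choose i else 0 := by
      intro j _
      rw [mul_pow, ← Polynomial.C_pow, ← Polynomial.C_pow,
        ← Polynomial.C_eq_natCast, show Polynomial.C (a ^ j) * Polynomial.X ^ j *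
        Polynomial.C (b ^ (m - j)) * Polynomial.C ((m.choose j : ℕ) : ℂ) =
        Polynomial.C (a ^ j * b ^ (m - j) * (m.choose j : ℕ)) * Polynomial.X ^ j by
          simp only [Polynomial.C_mul]; ring, Polynomial.coeff_C_mul_X_pow]
      split_ifs with h
      · rw [h]
      · rfl
    rw [Finset.sum_congr rfl this, Finset.sum_ite_eq]
    split_ifs with h
    · rfl
    · rw [Finset.mem_range, not_lt] at h
      rw [Nat.choose_eq_zero_of_lt (by omega)]; simp
  rw [mul_comm, Polynomial.coeff_mul, Finset.Nat.sum_antidiagonal_eq_sum_range_succ_mk, zern,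
    eval_radialPoly, Finset.mul_sum]
  push_cast
  refine Finset.sum_congr rfl fun i hi => ?_
  have hi' : i ≤ k := by simpa [Nat.lt_succ_iff] using hi
  have hs : (1 - (c : ℂ) ^ 2) = (s : ℂ) ^ 2 := by
    rw [eq_comm, eq_sub_iff_add_eq']; exact_mod_cast hcs
  rw [key, key, Nat.sub_sub_self hi', Nat.choose_symm hi', hs,
    show n + k - i = n + (k - i) by omega, neg_pow]
  ring

/-- The bound comes from Cauchy's estimate for the generating polynomial of `zern_eq_coeff`. On
the circle of radius `R` its two linear factors satisfy `|A|² + |B|² = 1 + R²`, and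
`R² = k / (n + k)` is the radius at which the resulting bound for the product of their powers is
exactly `R ^ k`. -/
theorem abs_zern_le_one (k n : ℕ) {c : ℝ} (h0 : 0 ≤ c) (h1 : c ≤ 1) : |zern k n c| ≤ 1 := by
  rcases Nat.eq_zero_or_pos k with rfl | hk
  · rw [zern_zero_left, abs_of_nonneg (pow_nonneg h0 _)]
    exact pow_le_one₀ h0 h1
  set s := Real.sqrt (1 - c ^ 2)
  have hs : c ^ 2 + s ^ 2 = 1 := by
    rw [Real.sq_sqrt (by nlinarith)]; ring
  set m := n + k with hm
  have hm0 : 0 < m := by omega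
  have hk' : (0 : ℝ) < k := by exact_mod_cast hk
  have hm' : (0 : ℝ) < m := by exact_mod_cast hm0
  set R : ℝ := Real.sqrt (k / m)
  have hR : 0 < R := Real.sqrt_pos.2 (by positivity)
  have hR2 : R ^ 2 = k / m := Real.sq_sqrt (by positivity)
  have h := norm_coeff_le_of_norm_eval_le
    ((Polynomial.C (c : ℂ) * Polynomial.X + Polynomial.C (-s : ℂ)) ^ k *
      (Polynomial.C (s : ℂ) * Polynomial.X + Polynomial.C (c : ℂ)) ^ m) k (C := R ^ k) hR ?_
  · rw [← zern_eq_coeff k n hs, Complex.norm_real, Real.norm_eq_abs, div_self (by positivity)] at h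
    exact h
  · intro z hz
    simp only [Polynomial.eval_mul, Polynomial.eval_pow, Polynomial.eval_add, Polynomial.eval_C,
      Polynomial.eval_X, norm_mul, norm_pow]
    set A := ‖(c : ℂ) * z + -s‖
    set B := ‖(s : ℂ) * z + c‖
    have hz2 : z.re ^ 2 + z.im ^ 2 = R ^ 2 := by
      rw [← hz, ← Complex.normSq_eq_norm_sq, Complex.normSq_apply]; ring
    have hAB : A ^ 2 + B ^ 2 = 1 + R ^ 2 := by
      rw [← Complex.normSq_eq_norm_sq, ← Complex.normSq_eq_norm_sq, Complex.normSq_apply,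
        Complex.normSq_apply]
      simp
      linear_combination (c ^ 2 + s ^ 2) * hz2 + (1 + R ^ 2) * hs
    have h1R : 0 < 1 + R ^ 2 := by positivity
    have hle := pow_mul_pow_le_of_add_eq_one (a := A ^ 2 / (1 + R ^ 2)) (b := B ^ 2 / (1 + R ^ 2))
      (by positivity) (by positivity) (by rw [← add_div, hAB, div_self h1R.ne']) hk hm0
    have e1 : (k : ℝ) / (k + m) = R ^ 2 / (1 + R ^ 2) := by rw [hR2]; field_simp; ring
    have e2 : (m : ℝ) / (k + m) = 1 / (1 + R ^ 2) := by rw [hR2]; field_simp; ring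
    rw [e1, e2, div_pow, div_pow, div_pow, div_pow, div_mul_div_comm, div_mul_div_comm,
      div_le_div_iff_of_pos_right (by positivity), one_pow, mul_one] at hle
    refine le_of_sq_le_sq (a := A ^ k * B ^ m) ?_ (by positivity)
    calc (A ^ k * B ^ m) ^ 2 = (A ^ 2) ^ k * (B ^ 2) ^ m := by ring
      _ ≤ _ := hle
      _ = _ := by ring

/-- The beta integral, after the substitution `x = c²`. -/
theorem integral_pow_mul_one_sub_sq_pow (a b : ℕ) :
    ∫ c in (0 : ℝ)..1, 2 * c * (c ^ 2) ^ a * (1 - c ^ 2) ^ b =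
      (a.factorial * b.factorial : ℝ) / (a + b + 1).factorial := by
  induction b generalizing a with
  | zero =>
    have : ∀ c : ℝ, 2 * c * (c ^ 2) ^ a * (1 - c ^ 2) ^ 0 = 2 * c ^ (2 * a + 1) := by
      intro c; ring
    simp only [this, intervalIntegral.integral_const_mul, integral_pow]
    rw [Nat.factorial_succ]
    push_cast
    have : (a.factorial : ℝ) ≠ 0 := by positivity
    simp
    field_simp
    ring
  | succ b ih =>
    have : ∀ c : ℝ, 2 * c * (c ^ 2) ^ a * (1 - c ^ 2) ^ (b + 1) =
      2 * c * (c ^ 2) ^ a * (1 - c ^ 2) ^ b - 2 * c * (c ^ 2) ^ (a + 1) * (1 - c ^ 2) ^ b := by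
      intro c; ring
    simp only [this]
    rw [intervalIntegral.integral_sub (Continuous.intervalIntegrable (by fun_prop) _ _)
      (Continuous.intervalIntegrable (by fun_prop) _ _), ih, ih,
      show a + 1 + b + 1 = (a + b + 1) + 1 by ring, show a + (b + 1) + 1 = (a + b + 1) + 1 by ring]
    simp only [Nat.factorial_succ]
    push_cast
    have : (a.factorial : ℝ) ≠ 0 := by positivity
    have : ((a + b).factorial : ℝ) ≠ 0 := by positivity
    field_simp
    ring

/-- The `k`-th finite difference of `x ↦ x.choose j`. -/
theorem sum_choose_mul_choose_add (k j x : ℕ) :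
    ∑ i ∈ Finset.range (k + 1), (-1 : ℝ) ^ i * (k.choose i) * ((x + (k - i)).choose j) =
      if j < k then (0 : ℝ) else (x.choose (j - k) : ℝ) := by
  have h := fwdDiff_iter_eq_sum_shift (1 : ℕ) (fun x ↦ (x.choose j : ℤ)) k x
  have h2 : (fwdDiff 1)^[k] (fun x ↦ (x.choose j : ℤ)) x =
      if j < k then 0 else (x.choose (j - k) : ℤ) := by
    split_ifs with hj
    · obtain ⟨d, rfl⟩ := Nat.exists_eq_add_of_lt hj
      have h0 : (fwdDiff 1)^[j] (fun x ↦ (x.choose j : ℤ)) = fun _ : ℕ => (1 : ℤ) := by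
        have := fwdDiff_iter_choose 0 j
        simpa using this
      rw [show j + d + 1 = (d + 1) + j by ring, Function.iterate_add_apply, h0,
        Function.iterate_succ_apply, fwdDiff_const]
      clear h h0
      induction d with
      | zero => rfl
      | succ d ih =>
        rw [Function.iterate_succ_apply, fwdDiff_const]
        exact ih (by omega)
    · have := fwdDiff_iter_choose (j - k) k
      rw [show k + (j - k) = j by omega] at this
      rw [this]
  rw [h2] at h
  rw [← Finset.sum_range_reflect]
  have h3 := congrArg (fun z : ℤ => (z : ℝ)) h
  push_cast at h3
  rw [h3]
  refine Finset.sum_congr rfl fun i hi => ?_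
  have hi' : i ≤ k := by simpa [Nat.lt_succ_iff] using hi
  rw [show k + 1 - 1 - i = k - i by omega, Nat.sub_sub_self hi', Nat.choose_symm hi']
  simp

theorem integral_zern_mul_pow (k n j : ℕ) (hj : j ≤ k) :
    ∫ c in (0 : ℝ)..1, 2 * c * zern k n c * (c ^ n * (c ^ 2) ^ j) =
      if j < k then 0 else ((n + k).factorial * k.factorial : ℝ) / (n + 2 * k + 1).factorial := by
  have h : ∀ c : ℝ, 2 * c * zern k n c * (c ^ n * (c ^ 2) ^ j) =
      ∑ i ∈ Finset.range (k + 1), ((-1) ^ i * (k.choose i : ℝ) * ((n + k).choose i : ℝ)) *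
        (2 * c * (c ^ 2) ^ (n + j + (k - i)) * (1 - c ^ 2) ^ i) := by
    intro c
    rw [zern, eval_radialPoly, Finset.mul_sum, Finset.mul_sum, Finset.sum_mul]
    refine Finset.sum_congr rfl fun i _ => ?_
    ring
  simp only [h]
  rw [intervalIntegral.integral_finsetSum
    (fun i _ => Continuous.intervalIntegrable (by fun_prop) _ _)]
  simp only [intervalIntegral.integral_const_mul, integral_pow_mul_one_sub_sq_pow]
  have h2 : ∀ i ∈ Finset.range (k + 1), ((-1) ^ i * (k.choose i : ℝ) * ((n + k).choose i : ℝ)) *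
      (((n + j + (k - i)).factorial * i.factorial : ℝ) / (n + j + (k - i) + i + 1).factorial) =
      ((n + k).factorial * j.factorial / (n + j + k + 1).factorial) *
       ((-1 : ℝ) ^ i * (k.choose i) * ((n + j + (k - i)).choose j)) := by
    intro i hi
    have hi' : i ≤ k := by simpa [Nat.lt_succ_iff] using hi
    rw [show n + j + (k - i) + i + 1 = n + j + k + 1 by omega]
    have e1 : ((n + k).factorial : ℝ) =
        (n + k).choose i * i.factorial * (n + (k - i)).factorial := by
      have := Nat.choose_mul_factorial_mul_factorial (show i ≤ n + k by omega)
      rw [show n + k - i = n + (k - i) by omega] at this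
      exact_mod_cast this.symm
    have e2 : ((n + j + (k - i)).factorial : ℝ) =
        (n + j + (k - i)).choose j * j.factorial * (n + (k - i)).factorial := by
      have := Nat.choose_mul_factorial_mul_factorial (show j ≤ n + j + (k - i) by omega)
      rw [show n + j + (k - i) - j = n + (k - i) by omega] at this
      exact_mod_cast this.symm
    rw [e1, e2]
    ring
  rw [Finset.sum_congr rfl h2, ← Finset.mul_sum, sum_choose_mul_choose_add]
  split_ifs with h3
  · simp
  · obtain rfl : j = k := by omega
    simp [show n + j + j + 1 = n + 2 * j + 1 by ring]

theorem continuous_zern (k n : ℕ) : Continuous (zern k n) := by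
  unfold zern
  exact (continuous_pow n).mul ((radialPoly k n).continuous.comp (continuous_pow 2))

theorem integral_zern_mul_zern (k k' n : ℕ) :
    ∫ c in (0 : ℝ)..1, 2 * c * (zern k n c * zern k' n c) =
      if k = k' then 1 / (2 * k + n + 1 : ℝ) else 0 := by
  wlog hkk : k' ≤ k generalizing k k'
  · have := this k' k (by omega)
    simp only [mul_comm (zern k n _), this]
    by_cases h : k = k'
    · simp [h]
    · simp [h, Ne.symm h]
  have h : ∀ c : ℝ, 2 * c * (zern k n c * zern k' n c) =
      ∑ j ∈ Finset.range (k' + 1), (radialPoly k' n).coeff j *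
        (2 * c * zern k n c * (c ^ n * (c ^ 2) ^ j)) := by
    intro c
    have : zern k' n c = c ^ n * ∑ j ∈ Finset.range (k' + 1),
        (radialPoly k' n).coeff j * (c ^ 2) ^ j := by
      rw [zern, Polynomial.eval_eq_sum_range' (Nat.lt_succ_of_le (natDegree_radialPoly_le k' n))]
    rw [this, Finset.mul_sum, Finset.mul_sum, Finset.mul_sum]
    exact Finset.sum_congr rfl fun j _ => by ring
  have hz := continuous_zern k n
  simp only [h]
  rw [intervalIntegral.integral_finsetSum
    (fun i _ => Continuous.intervalIntegrable (by fun_prop) _ _)]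
  simp only [intervalIntegral.integral_const_mul]
  have h2 : ∀ j ∈ Finset.range (k' + 1), (radialPoly k' n).coeff j *
      ∫ c in (0 : ℝ)..1, (2 * c * zern k n c * (c ^ n * (c ^ 2) ^ j)) =
      if j = k then (radialPoly k' n).coeff j *
        (((n + k).factorial * k.factorial : ℝ) / (n + 2 * k + 1).factorial) else 0 := by
    intro j hj
    have hj' : j ≤ k' := by simpa [Nat.lt_succ_iff] using hj
    rw [integral_zern_mul_pow k n j (by omega)]
    by_cases hjk : j = k
    · simp [hjk]
    · simp [hjk, show j < k by omega]
  rw [Finset.sum_congr rfl h2, Finset.sum_ite_eq']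
  by_cases hk : k = k'
  · subst hk
    simp only [Finset.mem_range, Nat.lt_succ_self, if_true, coeff_radialPoly]
    have := Nat.choose_mul_factorial_mul_factorial (show k ≤ n + 2 * k by omega)
    rw [show n + 2 * k - k = n + k by omega] at this
    have e : ((n + 2 * k).choose k : ℝ) * k.factorial * (n + k).factorial =
        (n + 2 * k).factorial := by
      exact_mod_cast this
    rw [Nat.factorial_succ]
    push_cast
    rw [← e]
    have : (((n + 2 * k).choose k : ℕ) : ℝ) ≠ 0 := by
      exact_mod_cast (Nat.choose_pos (by omega)).ne'
    field_simp
    ring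
  · have : k ∉ Finset.range (k' + 1) := by simp; omega
    simp [hk, this]

/-! ### Grouping the kernel by eigenvalues -/

/-- Half of the absolute value of the eigenvalue `lam k |n|` that belongs to the index `(n, k)`. -/
def level (q : ℤ × ℕ) : ℕ := q.1.natAbs + 2 * q.2 * (q.2 + q.1.natAbs + 1)

/-- The finite set of the indices `(n, k)` of level `L`; the product cut down here is large enough
to contain them all, see `mem_fiber`. -/
noncomputable def fiber (L : ℕ) : Finset (ℤ × ℕ) :=
  (Finset.Icc (-(L : ℤ)) L ×ˢ Finset.range (L + 1)).filter fun q => level q = L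

/-- The coefficient `2k + |n| + 1` of the kernel series. -/
def weight (q : ℤ × ℕ) : ℝ := 2 * (q.2 : ℝ) + (q.1.natAbs : ℝ) + 1

/-- The real part of the term of index `(n, k)` of the kernel series, without its coefficient and
its factor `e^{λt}`, in the variables `c = cos r` and `θ`. -/
noncomputable def mode (q : ℤ × ℕ) (c θ : ℝ) : ℝ :=
  zern q.2 q.1.natAbs c * Real.cos (q.1 * θ)

/-- The coefficient `f_L` of `e^{-2Lt}` in the kernel series. -/
noncomputable def layer (L : ℕ) (c θ : ℝ) : ℝ := ∑ q ∈ fiber L, weight q * mode q c θ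

/-- The value of `f_L` on the diagonal, which is also its maximum. -/
noncomputable def mult (L : ℕ) : ℝ := ∑ q ∈ fiber L, weight q

theorem add_le_level (q : ℤ × ℕ) : q.1.natAbs + 2 * q.2 ≤ level q := by
  unfold level
  nlinarith [Nat.zero_le (2 * q.2 * (q.2 + q.1.natAbs))]

theorem mem_fiber {L : ℕ} {q : ℤ × ℕ} : q ∈ fiber L ↔ level q = L := by
  refine ⟨fun h => (Finset.mem_filter.1 h).2, fun h => Finset.mem_filter.2 ⟨?_, h⟩⟩
  have := add_le_level q
  simp only [Finset.mem_product, Finset.mem_Icc, Finset.mem_range]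
  omega

theorem lam_eq (q : ℤ × ℕ) : lam q.2 q.1.natAbs = -(2 * (level q : ℝ)) := by
  unfold lam level
  push_cast
  ring

theorem weight_pos (q : ℤ × ℕ) : 0 < weight q := by unfold weight; positivity

theorem abs_mode_le_one (q : ℤ × ℕ) {c : ℝ} (h0 : 0 ≤ c) (h1 : c ≤ 1) (θ : ℝ) :
    |mode q c θ| ≤ 1 := by
  rw [mode, abs_mul]
  exact mul_le_one₀ (abs_zern_le_one _ _ h0 h1) (abs_nonneg _) (Real.abs_cos_le_one _)

theorem mult_nonneg (L : ℕ) : 0 ≤ mult L := Finset.sum_nonneg fun q _ => (weight_pos q).le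

theorem abs_layer_le (L : ℕ) {c : ℝ} (h0 : 0 ≤ c) (h1 : c ≤ 1) (θ : ℝ) :
    |layer L c θ| ≤ mult L := by
  refine (Finset.abs_sum_le_sum_abs _ _).trans (Finset.sum_le_sum fun q _ => ?_)
  rw [abs_mul, abs_of_pos (weight_pos q)]
  exact mul_le_of_le_one_right (weight_pos q).le (abs_mode_le_one q h0 h1 θ)

theorem layer_one_zero (L : ℕ) : layer L 1 0 = mult L := by
  simp [layer, mult, mode, zern_one]

theorem fiber_zero : fiber 0 = {(0, 0)} := by decide

theorem fiber_one : fiber 1 = {(1, 0), (-1, 0)} := by decide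

theorem layer_zero (c θ : ℝ) : layer 0 c θ = 1 := by
  simp [layer, fiber_zero, weight, mode, zern_zero_left]

theorem layer_one (c θ : ℝ) : layer 1 c θ = 4 * (c * Real.cos θ) := by
  rw [layer, fiber_one, Finset.sum_pair (by decide)]
  simp [weight, mode, zern_zero_left]
  ring

theorem mult_zero : mult 0 = 1 := by
  rw [← layer_one_zero, layer_zero]

/-- The series is dominated by a product of two series, as `level (n, k) ≥ |n| + 2k`. -/
theorem summable_weight {t : ℝ} (ht : 0 < t) :
    Summable fun q : ℤ × ℕ => weight q * Real.exp (-(2 * (level q : ℝ)) * t) := by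
  have h1 : Summable fun n : ℕ => ((n : ℝ) + 1) * Real.exp (-(2 * t)) ^ n := by
    have hr : ‖Real.exp (-(2 * t))‖ < 1 := by
      rw [Real.norm_eq_abs, Real.abs_exp]
      exact (Real.exp_lt_exp.2 (by linarith)).trans_eq Real.exp_zero
    have a := summable_pow_mul_geometric_of_norm_lt_one 1 hr
    have b := summable_pow_mul_geometric_of_norm_lt_one 0 hr
    refine (a.add b).congr fun n => ?_
    simp; ring
  have h2 : Summable fun n : ℤ => ((n.natAbs : ℝ) + 1) * Real.exp (-(2 * t)) ^ n.natAbs := by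
    refine Summable.of_nat_of_neg ?_ ?_
    · simpa using h1
    · simpa using h1
  have h3 : Summable fun k : ℕ => (2 * (k : ℝ) + 1) * Real.exp (-(2 * t)) ^ (2 * k) := by
    have : Function.Injective fun k : ℕ => 2 * k := fun a b h => by simpa using h
    have := h1.comp_injective this
    refine this.congr fun k => ?_
    simp
  refine Summable.of_nonneg_of_le (fun q => ?_) (fun q => ?_)
    (h2.mul_of_nonneg h3 (fun n => by positivity) (fun k => by positivity))
  · have := weight_pos q
    positivity
  · have e : Real.exp (-(2 * (level q : ℝ)) * t) ≤
        Real.exp (-(2 * t)) ^ q.1.natAbs * Real.exp (-(2 * t)) ^ (2 * q.2) := by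
      rw [← pow_add, ← Real.exp_nat_mul]
      apply Real.exp_le_exp.2
      have : ((q.1.natAbs + 2 * q.2 : ℕ) : ℝ) ≤ level q := by exact_mod_cast add_le_level q
      nlinarith
    have w : weight q ≤ ((q.1.natAbs : ℝ) + 1) * (2 * (q.2 : ℝ) + 1) := by
      unfold weight
      have : (0 : ℝ) ≤ (q.1.natAbs : ℝ) * q.2 := by positivity
      nlinarith
    calc _ ≤ (((q.1.natAbs : ℝ) + 1) * (2 * (q.2 : ℝ) + 1)) *
          (Real.exp (-(2 * t)) ^ q.1.natAbs * Real.exp (-(2 * t)) ^ (2 * q.2)) := by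
          gcongr
      _ = _ := by ring

theorem hasSum_sum_fiber {f : ℤ × ℕ → ℝ} {a : ℝ} (h : HasSum f a) :
    HasSum (fun L => ∑ q ∈ fiber L, f q) a := by
  have := h.tsum_fiberwise level
  refine this.congr_fun fun L => ?_
  have e : level ⁻¹' {L} = (fiber L : Set (ℤ × ℕ)) := by
    ext q; simp [mem_fiber]
  rw [e, Finset.tsum_subtype']

theorem summable_mult {t : ℝ} (ht : 0 < t) :
    Summable fun L : ℕ => mult L * Real.exp (-(2 * (L : ℝ)) * t) := by
  refine (hasSum_sum_fiber (summable_weight ht).hasSum).summable.congr fun L => ?_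
  rw [mult, Finset.sum_mul]
  refine Finset.sum_congr rfl fun q hq => ?_
  rw [mem_fiber.1 hq]

theorem hasSum_kernelSeries {t r : ℝ} (ht : 0 < t) (hr : 0 ≤ Real.cos r) (θ : ℝ) :
    HasSum (fun L : ℕ => Real.exp (-(2 * (L : ℝ)) * t) * layer L (Real.cos r) θ)
      (kernelSeries t r θ).re := by
  have hterm : ∀ q : ℤ × ℕ, (((2 * (q.2 : ℝ) + (q.1.natAbs : ℝ) + 1) *
      Real.exp (lam q.2 q.1.natAbs * t) : ℝ) : ℂ) *
      Complex.exp (Complex.I * (q.1 : ℂ) * (θ : ℂ)) *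
      ((Real.cos r ^ q.1.natAbs * jacobi q.2 q.1.natAbs (Real.cos (2 * r)) : ℝ) : ℂ) =
      ((weight q * Real.exp (-(2 * (level q : ℝ)) * t) *
          zern q.2 q.1.natAbs (Real.cos r) : ℝ) : ℂ) *
        Complex.exp (((q.1 * θ : ℝ) : ℂ) * Complex.I) := by
    intro q
    rw [cos_pow_mul_jacobi, lam_eq, weight]
    push_cast
    rw [show Complex.I * (q.1 : ℂ) * (θ : ℂ) = (q.1 : ℂ) * θ * Complex.I by ring]
    ring
  have hs : Summable fun q : ℤ × ℕ =>
      ((weight q * Real.exp (-(2 * (level q : ℝ)) * t) *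
          zern q.2 q.1.natAbs (Real.cos r) : ℝ) : ℂ) *
        Complex.exp (((q.1 * θ : ℝ) : ℂ) * Complex.I) := by
    refine Summable.of_norm_bounded (summable_weight ht) fun q => ?_
    rw [norm_mul, Complex.norm_exp_ofReal_mul_I, mul_one, Complex.norm_real, Real.norm_eq_abs,
      abs_mul, abs_of_nonneg (mul_nonneg (weight_pos q).le (Real.exp_pos _).le)]
    exact mul_le_of_le_one_right (mul_nonneg (weight_pos q).le (Real.exp_pos _).le)
      (abs_zern_le_one _ _ hr (Real.cos_le_one r))
  have h1 := Complex.hasSum_re hs.hasSum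
  have h2 : kernelSeries t r θ = _ := tsum_congr hterm
  rw [h2]
  refine (hasSum_sum_fiber h1).congr_fun fun L => ?_
  rw [layer, Finset.mul_sum]
  refine Finset.sum_congr rfl fun q hq => ?_
  rw [Complex.re_ofReal_mul, Complex.exp_ofReal_mul_I_re, mem_fiber.1 hq, mode]
  ring

/-! ### Trigonometric polynomials on the half disk -/

/-- The function `Re (w ^ p conj(w) ^ q)` of `w = c e^{iθ}`, in the polar coordinates `(c, θ)`. -/
noncomputable def trig (p q : ℕ) : ℝ × ℝ → ℝ := fun z =>
  z.1 ^ (p + q) * Real.cos (((p : ℝ) - q) * z.2)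

/-- The real polynomials in `w`, `conj w` of degree at most `d` that are invariant under
`w ↦ conj w`. -/
noncomputable def trigDeg (d : ℕ) : Submodule ℝ (ℝ × ℝ → ℝ) :=
  Submodule.span ℝ {f | ∃ p q, p + q ≤ d ∧ f = trig p q}

/-- `f_L` as a function of the pair `(c, θ)`. -/
noncomputable def layerFun (L : ℕ) : ℝ × ℝ → ℝ := fun z => layer L z.1 z.2

theorem trig_mem {p q d : ℕ} (h : p + q ≤ d) : trig p q ∈ trigDeg d :=
  Submodule.subset_span ⟨p, q, h, rfl⟩

theorem trigDeg_mono {d e : ℕ} (h : d ≤ e) : trigDeg d ≤ trigDeg e :=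
  Submodule.span_mono fun _ ⟨p, q, hpq, hf⟩ => ⟨p, q, hpq.trans h, hf⟩

theorem trig_comm (p q : ℕ) : trig p q = trig q p := by
  funext z
  rw [trig, trig, add_comm, ← Real.cos_neg]
  congr 2
  ring

theorem trig_mul_trig (p q p' q' : ℕ) : trig p q * trig p' q' =
    (1 / 2 : ℝ) • (trig (p + p') (q + q') + trig (p + q') (q + p')) := by
  funext z
  simp only [trig, Pi.mul_apply, Pi.smul_apply, Pi.add_apply, smul_eq_mul]
  have h := Real.cos_add (((p : ℝ) - q) * z.2) (((p' : ℝ) - q') * z.2)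
  have h' := Real.cos_sub (((p : ℝ) - q) * z.2) (((p' : ℝ) - q') * z.2)
  rw [show ((p : ℝ) - q) * z.2 + ((p' : ℝ) - q') * z.2 =
    (((p + p' : ℕ) : ℝ) - ((q + q' : ℕ) : ℝ)) * z.2 by push_cast; ring] at h
  rw [show ((p : ℝ) - q) * z.2 - ((p' : ℝ) - q') * z.2 =
    (((p + q' : ℕ) : ℝ) - ((q + p' : ℕ) : ℝ)) * z.2 by push_cast; ring] at h'
  rw [h, h']
  ring

theorem mul_mem_trigDeg {d e : ℕ} {f g : ℝ × ℝ → ℝ} (hf : f ∈ trigDeg d) (hg : g ∈ trigDeg e) :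
    f * g ∈ trigDeg (d + e) := by
  have h := Submodule.mul_mem_mul hf hg
  rw [trigDeg, trigDeg, Submodule.span_mul_span] at h
  refine (Submodule.span_le.2 ?_) h
  rintro _ ⟨_, ⟨p, q, hpq, rfl⟩, _, ⟨p', q', hpq', rfl⟩, rfl⟩
  change trig p q * trig p' q' ∈ trigDeg (d + e)
  rw [trig_mul_trig]
  exact Submodule.smul_mem _ _ (Submodule.add_mem _ (trig_mem (by omega)) (trig_mem (by omega)))

theorem cos_intCast_mul (n : ℤ) (θ : ℝ) : Real.cos (n * θ) = Real.cos (n.natAbs * θ) := by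
  rcases Int.natAbs_eq n with h | h
  · conv_lhs => rw [h]
    simp
  · conv_lhs => rw [h]
    simp

theorem mode_mem_trigDeg (q : ℤ × ℕ) :
    (fun z : ℝ × ℝ => mode q z.1 z.2) ∈ trigDeg (q.1.natAbs + 2 * q.2) := by
  have h : (fun z : ℝ × ℝ => mode q z.1 z.2) = ∑ j ∈ Finset.range (q.2 + 1),
      (radialPoly q.2 q.1.natAbs).coeff j • trig (q.1.natAbs + j) j := by
    funext z
    rw [mode, zern, cos_intCast_mul,
      Polynomial.eval_eq_sum_range' (Nat.lt_succ_of_le (natDegree_radialPoly_le _ _)),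
      Finset.sum_apply, Finset.mul_sum, Finset.sum_mul]
    refine Finset.sum_congr rfl fun j _ => ?_
    simp only [trig, Pi.smul_apply, smul_eq_mul]
    push_cast
    rw [add_sub_cancel_right]
    ring
  rw [h]
  refine Submodule.sum_mem _ fun j hj => Submodule.smul_mem _ _ (trig_mem ?_)
  have : j ≤ q.2 := by simpa [Nat.lt_succ_iff] using hj
  omega

theorem layerFun_eq (L : ℕ) :
    layerFun L = ∑ q ∈ fiber L, weight q • fun z : ℝ × ℝ => mode q z.1 z.2 := by
  funext z
  simp [layerFun, layer, Finset.sum_apply]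

/-- The indices `(±L, 0)` contribute `2(L + 1) Re w^L` to `f_L`; all the others of level `L` have
degree `|n| + 2k < L`. -/
theorem layerFun_sub_mem {L : ℕ} (hL : 0 < L) :
    layerFun L - (2 * (L + 1) : ℝ) • trig L 0 ∈ trigDeg (L - 1) := by
  rw [layerFun_eq, ← Finset.sum_filter_add_sum_filter_not _ (fun q : ℤ × ℕ => q.2 = 0)]
  have h0 : (fiber L).filter (fun q => q.2 = 0) = {((L : ℤ), 0), (-(L : ℤ), 0)} := by
    ext ⟨n, k⟩
    simp only [Finset.mem_filter, mem_fiber, level, Finset.mem_insert, Finset.mem_singleton,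
      Prod.mk.injEq]
    constructor
    · rintro ⟨h, rfl⟩
      simp at h
      omega
    · rintro (⟨rfl, rfl⟩ | ⟨rfl, rfl⟩) <;> simp
  rw [h0, Finset.sum_pair (by simp; omega)]
  have h1 : ((weight ((L : ℤ), 0) • fun z : ℝ × ℝ => mode ((L : ℤ), 0) z.1 z.2) +
      weight (-(L : ℤ), 0) • fun z : ℝ × ℝ => mode (-(L : ℤ), 0) z.1 z.2) =
      (2 * (L + 1) : ℝ) • trig L 0 := by
    funext z
    simp [weight, mode, trig, zern_zero_left]
    ring
  rw [h1, add_sub_cancel_left]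
  refine Submodule.sum_mem _ fun q hq => Submodule.smul_mem _ _ ?_
  rw [Finset.mem_filter, mem_fiber] at hq
  refine trigDeg_mono ?_ (mode_mem_trigDeg q)
  have hk : 1 ≤ q.2 := Nat.one_le_iff_ne_zero.2 hq.2
  have : q.1.natAbs + 2 * q.2 + 1 ≤ level q := by
    unfold level
    nlinarith [Nat.zero_le (q.2 * (q.2 + q.1.natAbs)), Nat.mul_le_mul hk hk,
      Nat.zero_le (q.2 * q.1.natAbs)]
  omega

/-- The functions `f_L` and their products span all the spaces `trigDeg d`. By induction on the
degree: modulo lower degrees, `f_d` is a multiple of `Re w^d`, and `f_p f_q` is a multiple of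
`Re w^p Re w^q = ½ (Re w^{p+q} + Re (w^p conj(w)^q))`. -/
theorem trigDeg_le_of_layerFun_mem (S : Submodule ℝ (ℝ × ℝ → ℝ)) (h1 : ∀ L, layerFun L ∈ S)
    (h2 : ∀ L L', layerFun L * layerFun L' ∈ S) (d : ℕ) : trigDeg d ≤ S := by
  suffices H : ∀ d p q, p + q = d → trig p q ∈ S by
    refine Submodule.span_le.2 ?_
    rintro _ ⟨p, q, _, rfl⟩
    exact H _ p q rfl
  intro d
  induction d using Nat.strong_induction_on with
  | _ d ih =>
  have ih' : ∀ e, e < d → trigDeg e ≤ S := by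
    intro e he
    refine Submodule.span_le.2 ?_
    rintro _ ⟨p, q, hpq, rfl⟩
    exact ih (p + q) (by omega) p q rfl
  have hd : trig d 0 ∈ S := by
    rcases Nat.eq_zero_or_pos d with rfl | hd
    · have : trig 0 0 = layerFun 0 := by
        funext z; simp [trig, layerFun, layer_zero]
      rw [this]
      exact h1 0
    · have := S.sub_mem (h1 d) (ih' (d - 1) (by omega) (layerFun_sub_mem hd))
      rw [sub_sub_cancel] at this
      exact (S.smul_mem_iff (by positivity)).1 this
  intro p q hpq
  rcases Nat.eq_zero_or_pos q with rfl | hq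
  · rw [add_zero] at hpq
    exact hpq ▸ hd
  rcases Nat.eq_zero_or_pos p with rfl | hp
  · rw [zero_add] at hpq
    rw [trig_comm, hpq]
    exact hd
  set a := layerFun p - (2 * (p + 1) : ℝ) • trig p 0 with ha
  set b := layerFun q - (2 * (q + 1) : ℝ) • trig q 0 with hb
  have ha' : a ∈ trigDeg (p - 1) := layerFun_sub_mem hp
  have hb' : b ∈ trigDeg (q - 1) := layerFun_sub_mem hq
  have hp0 : trig p 0 ∈ trigDeg p := trig_mem (by omega)
  have hq0 : trig q 0 ∈ trigDeg q := trig_mem (by omega)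
  -- the terms of lower degree in the product of `f_p` and `f_q`
  have hlow : (2 * (p + 1) : ℝ) • (trig p 0 * b) + (2 * (q + 1) : ℝ) • (a * trig q 0) +
      a * b ∈ S := by
    refine ih' (p + q - 1) (by omega) (Submodule.add_mem _ (Submodule.add_mem _
      (Submodule.smul_mem _ _ ?_) (Submodule.smul_mem _ _ ?_)) ?_)
    · exact trigDeg_mono (by omega) (mul_mem_trigDeg hp0 hb')
    · exact trigDeg_mono (by omega) (mul_mem_trigDeg ha' hq0)
    · exact trigDeg_mono (by omega) (mul_mem_trigDeg ha' hb')
  have hprod : trig p 0 * trig q 0 = (1 / 2 : ℝ) • (trig (p + q) 0 + trig p q) := by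
    rw [trig_mul_trig]; simp
  have e : layerFun p * layerFun q - ((2 * (p + 1) : ℝ) • (trig p 0 * b) +
      (2 * (q + 1) : ℝ) • (a * trig q 0) + a * b) - (2 * (p + 1) * (q + 1) : ℝ) • trig (p + q) 0 =
      (2 * (p + 1) * (q + 1) : ℝ) • trig p q := by
    have h3 : layerFun p = a + (2 * (p + 1) : ℝ) • trig p 0 := by rw [ha]; abel
    have h4 : layerFun q = b + (2 * (q + 1) : ℝ) • trig q 0 := by rw [hb]; abel
    rw [h3, h4]
    funext z
    have := congrFun hprod z
    simp only [Pi.mul_apply, Pi.smul_apply, Pi.add_apply, Pi.sub_apply, smul_eq_mul] at this ⊢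
    linear_combination (4 * (p + 1) * (q + 1) : ℝ) * this
  have := S.sub_mem (S.sub_mem (h2 p q) hlow)
    (S.smul_mem (2 * (p + 1) * (q + 1) : ℝ) (hpq ▸ hd : trig (p + q) 0 ∈ S))
  rw [e] at this
  exact (S.smul_mem_iff (by positivity)).1 this

/-- The mean over the upper half of the unit disk, in the polar coordinates `(c, θ)`. For functions
invariant under `θ ↦ -θ` it is the mean over the disk. -/
noncomputable def diskIntegral (g : ℝ × ℝ → ℝ) : ℝ :=
  ∫ z in Set.Icc (0 : ℝ) 1 ×ˢ Set.Icc (0 : ℝ) Real.pi, 2 * z.1 / Real.pi * g z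

theorem integrableOn_disk {g : ℝ × ℝ → ℝ} (hg : Continuous g) :
    IntegrableOn (fun z : ℝ × ℝ => 2 * z.1 / Real.pi * g z)
      (Set.Icc (0 : ℝ) 1 ×ˢ Set.Icc (0 : ℝ) Real.pi) := by
  refine ContinuousOn.integrableOn_compact (isCompact_Icc.prod isCompact_Icc) ?_
  exact (by fun_prop : Continuous fun z : ℝ × ℝ => 2 * z.1 / Real.pi * g z).continuousOn

theorem diskIntegral_add {f g : ℝ × ℝ → ℝ} (hf : Continuous f) (hg : Continuous g) :
    diskIntegral (f + g) = diskIntegral f + diskIntegral g := by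
  rw [diskIntegral, diskIntegral, diskIntegral,
    ← integral_add (integrableOn_disk hf) (integrableOn_disk hg)]
  congr 1
  funext z
  simp [mul_add]

theorem diskIntegral_smul (a : ℝ) (g : ℝ × ℝ → ℝ) :
    diskIntegral (a • g) = a * diskIntegral g := by
  rw [diskIntegral, diskIntegral, ← integral_const_mul]
  congr 1
  funext z
  simp; ring

theorem diskIntegral_zero : diskIntegral 0 = 0 := by simp [diskIntegral]

theorem continuous_sum_fun {ι : Type*} {s : Finset ι} {f : ι → ℝ × ℝ → ℝ}
    (hf : ∀ i ∈ s, Continuous (f i)) : Continuous (∑ i ∈ s, f i) := by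
  rw [Finset.sum_fn]
  exact continuous_finsetSum s hf

theorem diskIntegral_sum {ι : Type*} (s : Finset ι) (f : ι → ℝ × ℝ → ℝ)
    (hf : ∀ i ∈ s, Continuous (f i)) :
    diskIntegral (∑ i ∈ s, f i) = ∑ i ∈ s, diskIntegral (f i) := by
  classical
  induction s using Finset.induction_on with
  | empty => simp [diskIntegral_zero]
  | insert i s hi ih =>
    rw [Finset.sum_insert hi, Finset.sum_insert hi, diskIntegral_add (hf i (by simp)), ih]
    · exact fun j hj => hf j (Finset.mem_insert_of_mem hj)
    · exact continuous_sum_fun fun j hj => hf j (Finset.mem_insert_of_mem hj)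

theorem diskIntegral_mul (f g : ℝ → ℝ) : diskIntegral (fun z => f z.1 * g z.2) =
    (∫ c in (0 : ℝ)..1, 2 * c * f c) * ((∫ θ in (0 : ℝ)..Real.pi, g θ) / Real.pi) := by
  have h : ∀ z : ℝ × ℝ, 2 * z.1 / Real.pi * (f z.1 * g z.2) =
      (2 * z.1 * f z.1) * (g z.2 / Real.pi) := fun z => by ring
  rw [diskIntegral]
  simp only [h]
  rw [Measure.volume_eq_prod, setIntegral_prod_mul (fun c => 2 * c * f c) (fun θ => g θ / Real.pi),
    integral_Icc_eq_integral_Ioc, integral_Icc_eq_integral_Ioc,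
    ← intervalIntegral.integral_of_le zero_le_one, ← intervalIntegral.integral_of_le Real.pi_pos.le,
    intervalIntegral.integral_div]

theorem integral_cos_intCast_mul (n : ℤ) :
    ∫ θ in (0 : ℝ)..Real.pi, Real.cos (n * θ) = if n = 0 then Real.pi else 0 := by
  split_ifs with h
  · simp [h]
  · have hn : (n : ℝ) ≠ 0 := by exact_mod_cast h
    rw [intervalIntegral.integral_comp_mul_left _ hn]
    simp [Real.sin_int_mul_pi]

theorem integral_cos_mul_cos (n m : ℤ) :
    (∫ θ in (0 : ℝ)..Real.pi, Real.cos (n * θ) * Real.cos (m * θ)) / Real.pi =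
      ((if n = m then 1 else 0) + (if n = -m then 1 else 0)) / 2 := by
  have h : ∀ θ : ℝ, Real.cos (n * θ) * Real.cos (m * θ) =
      Real.cos (((n - m : ℤ) : ℝ) * θ) / 2 + Real.cos (((n + m : ℤ) : ℝ) * θ) / 2 := by
    intro θ
    have h := Real.cos_add (n * θ) (m * θ)
    have h' := Real.cos_sub (n * θ) (m * θ)
    push_cast
    rw [sub_mul, add_mul, h, h']
    ring
  simp only [h]
  rw [intervalIntegral.integral_add (Continuous.intervalIntegrable (by fun_prop) _ _)
      (Continuous.intervalIntegrable (by fun_prop) _ _), intervalIntegral.integral_div,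
    intervalIntegral.integral_div, integral_cos_intCast_mul, integral_cos_intCast_mul]
  simp only [sub_eq_zero, ← eq_neg_iff_add_eq_zero]
  have := Real.pi_pos.ne'
  split_ifs <;> field_simp <;> norm_num

theorem continuous_mode (q : ℤ × ℕ) : Continuous fun z : ℝ × ℝ => mode q z.1 z.2 := by
  unfold mode
  have := continuous_zern q.2 q.1.natAbs
  fun_prop

theorem continuous_layerFun (L : ℕ) : Continuous (layerFun L) := by
  rw [layerFun_eq]
  exact continuous_sum_fun fun q _ => (continuous_mode q).const_smul (weight q)

theorem diskIntegral_mode_mul_mode (q q' : ℤ × ℕ) :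
    diskIntegral ((fun z => mode q z.1 z.2) * fun z => mode q' z.1 z.2) =
      ((if q' = q then 1 else 0) + (if q' = (-q.1, q.2) then 1 else 0)) / (2 * weight q) := by
  have h : ((fun z : ℝ × ℝ => mode q z.1 z.2) * fun z => mode q' z.1 z.2) =
      fun z => (zern q.2 q.1.natAbs z.1 * zern q'.2 q'.1.natAbs z.1) *
        (Real.cos (q.1 * z.2) * Real.cos (q'.1 * z.2)) := by
    funext z
    simp only [Pi.mul_apply, mode]
    ring
  rw [h, diskIntegral_mul (fun c => zern q.2 q.1.natAbs c * zern q'.2 q'.1.natAbs c)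
    (fun θ => Real.cos (q.1 * θ) * Real.cos (q'.1 * θ)), integral_cos_mul_cos]
  obtain ⟨n, k⟩ := q
  obtain ⟨n', k'⟩ := q'
  simp only [Prod.mk.injEq]
  by_cases hn : n.natAbs = n'.natAbs
  · rw [← hn, integral_zern_mul_zern]
    have hw : (2 * k + n.natAbs + 1 : ℝ) ≠ 0 := by positivity
    by_cases hk : k = k'
    · subst hk
      simp only [if_true, and_true, weight, eq_comm (a := n') (b := n),
        show (n' = -n ↔ n = -n') by omega]
      field_simp
    · simp [hk, Ne.symm hk]
  · have h1 : n ≠ n' := by rintro rfl; exact hn rfl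
    have h2 : n ≠ -n' := by rintro rfl; simp at hn
    have h3 : n' ≠ -n := by rintro rfl; simp at hn
    simp [h1, h2, h3, h1.symm]

/-- On the half disk the `f_L` satisfy the relations that hold on `M` for `f_L(x, ·)`. -/
theorem diskIntegral_layerFun_mul_layerFun (L L' : ℕ) :
    diskIntegral (layerFun L * layerFun L') = if L = L' then mult L else 0 := by
  have h : layerFun L * layerFun L' = ∑ q ∈ fiber L, ∑ q' ∈ fiber L', (weight q * weight q') •
      ((fun z : ℝ × ℝ => mode q z.1 z.2) * fun z => mode q' z.1 z.2) := by
    rw [layerFun_eq, layerFun_eq, Finset.sum_mul_sum]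
    refine Finset.sum_congr rfl fun q _ => Finset.sum_congr rfl fun q' _ => ?_
    rw [smul_mul_smul_comm]
  have hc : ∀ q q' : ℤ × ℕ, Continuous ((weight q * weight q') •
      ((fun z : ℝ × ℝ => mode q z.1 z.2) * fun z => mode q' z.1 z.2)) := fun q q' =>
    ((continuous_mode q).mul (continuous_mode q')).const_smul _
  rw [h, diskIntegral_sum _ _ fun q _ => continuous_sum_fun fun q' _ => hc q q']
  have h2 : ∀ q ∈ fiber L, diskIntegral (∑ q' ∈ fiber L', (weight q * weight q') •
      ((fun z : ℝ × ℝ => mode q z.1 z.2) * fun z => mode q' z.1 z.2)) =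
      if L = L' then weight q else 0 := by
    intro q hq
    have hqL := mem_fiber.1 hq
    rw [diskIntegral_sum _ _ fun q' _ => hc q q']
    simp only [diskIntegral_smul, diskIntegral_mode_mul_mode]
    have h3 : ∀ q' : ℤ × ℕ, weight q * weight q' * (((if q' = q then 1 else 0) +
        (if q' = (-q.1, q.2) then 1 else 0)) / (2 * weight q)) =
        (if q' = q then weight q / 2 else 0) + (if q' = (-q.1, q.2) then weight q / 2 else 0) := by
      intro q'
      have := (weight_pos q).ne'
      by_cases e : q' = q ∨ q' = (-q.1, q.2)
      · have hw : weight q' = weight q := by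
          rcases e with e | e <;> rw [e]
          simp [weight]
        rw [hw]
        split_ifs <;> field_simp <;> ring
      · rw [not_or] at e
        simp [e.1, e.2]
    simp only [h3, Finset.sum_add_distrib, Finset.sum_ite_eq', mem_fiber]
    have h4 : level (-q.1, q.2) = level q := by simp [level]
    rw [h4, hqL]
    split_ifs <;> ring
  rw [Finset.sum_congr rfl h2]
  split_ifs
  · rfl
  · simp

theorem diskIntegral_layerFun (L : ℕ) : diskIntegral (layerFun L) = if L = 0 then 1 else 0 := by
  have h := diskIntegral_layerFun_mul_layerFun L 0
  have h0 : layerFun 0 = 1 := by funext z; simp [layerFun, layer_zero]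
  rw [h0, mul_one] at h
  rw [h]
  split_ifs with hL
  · rw [hL, mult_zero]
  · rfl

/-- The `N`-th moment of `Re w` for `w` uniformly distributed in the unit disk; equivalently, of a
coordinate on the unit sphere `S³`. -/
noncomputable def diskMoment (N : ℕ) : ℝ := diskIntegral (fun z => (z.1 * Real.cos z.2) ^ N)

theorem diskMoment_eq (N : ℕ) : diskMoment N =
    2 / (N + 2) * ((∫ θ in (0 : ℝ)..Real.pi, Real.cos θ ^ N) / Real.pi) := by
  have h : ∀ z : ℝ × ℝ, (z.1 * Real.cos z.2) ^ N = z.1 ^ N * Real.cos z.2 ^ N :=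
    fun z => mul_pow _ _ _
  have h2 : ∀ c : ℝ, 2 * c * c ^ N = 2 * c ^ (N + 1) := fun c => by ring
  rw [diskMoment]
  simp only [h]
  rw [diskIntegral_mul (fun c => c ^ N) (fun θ => Real.cos θ ^ N)]
  simp only [h2, intervalIntegral.integral_const_mul, integral_pow]
  congr 1
  push_cast
  simp
  ring

theorem diskMoment_zero : diskMoment 0 = 1 := by
  rw [diskMoment_eq]
  have := Real.pi_pos.ne'
  simp [this]

theorem diskMoment_one : diskMoment 1 = 0 := by
  rw [diskMoment_eq]
  simp

theorem diskMoment_add_two (N : ℕ) :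
    diskMoment (N + 2) = ((N : ℝ) + 1) / (N + 4) * diskMoment N := by
  rw [diskMoment_eq, diskMoment_eq, integral_cos_pow]
  have := Real.pi_pos.ne'
  push_cast
  simp
  field_simp
  ring

/-- The integrals of the `f_L` and of their pairwise products along `γ = (c, θ)` determine the
moments of `c cos θ`. -/
theorem integral_pow_eq_diskMoment {M : Type*} [MeasurableSpace M] {μ : Measure M} (γ : M → ℝ × ℝ)
    (hi : ∀ L, Integrable (fun y => layerFun L (γ y)) μ)
    (hi2 : ∀ L L', Integrable (fun y => layerFun L (γ y) * layerFun L' (γ y)) μ)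
    (h1 : ∀ L, ∫ y, layerFun L (γ y) ∂μ = if L = 0 then 1 else 0)
    (h2 : ∀ L L', ∫ y, layerFun L (γ y) * layerFun L' (γ y) ∂μ = if L = L' then mult L else 0)
    (N : ℕ) : ∫ y, ((γ y).1 * Real.cos (γ y).2) ^ N ∂μ = diskMoment N := by
  -- the functions whose mean along `γ` is the mean over the half disk
  let S : Submodule ℝ (ℝ × ℝ → ℝ) :=
    { carrier := {g | Continuous g ∧ Integrable (fun y => g (γ y)) μ ∧
        ∫ y, g (γ y) ∂μ = diskIntegral g}
      zero_mem' := ⟨continuous_zero, by simp, by simp [diskIntegral_zero]⟩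
      add_mem' := by
        rintro f g ⟨hf, hf1, hf2⟩ ⟨hg, hg1, hg2⟩
        refine ⟨hf.add hg, hf1.add hg1, ?_⟩
        rw [diskIntegral_add hf hg, ← hf2, ← hg2, ← integral_add hf1 hg1]
        rfl
      smul_mem' := by
        rintro a f ⟨hf, hf1, hf2⟩
        refine ⟨hf.const_smul a, hf1.const_mul a, ?_⟩
        rw [diskIntegral_smul, ← hf2, ← integral_const_mul]
        rfl }
  have hS := trigDeg_le_of_layerFun_mem S
    (fun L => ⟨continuous_layerFun L, hi L, by rw [h1, diskIntegral_layerFun]⟩)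
    (fun L L' => ⟨(continuous_layerFun L).mul (continuous_layerFun L'), hi2 L L',
      (h2 L L').trans (diskIntegral_layerFun_mul_layerFun L L').symm⟩)
  have hpow : ∀ N, (fun z : ℝ × ℝ => (z.1 * Real.cos z.2) ^ N) ∈ trigDeg N := by
    intro N
    induction N with
    | zero =>
      have : (fun z : ℝ × ℝ => (z.1 * Real.cos z.2) ^ 0) = trig 0 0 := by
        funext z; simp [trig]
      rw [this]
      exact trig_mem le_rfl
    | succ N ih =>
      have : (fun z : ℝ × ℝ => (z.1 * Real.cos z.2) ^ (N + 1)) =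
          (fun z : ℝ × ℝ => (z.1 * Real.cos z.2) ^ N) * trig 1 0 := by
        funext z; simp [trig, pow_succ]
      rw [this]
      exact mul_mem_trigDeg ih (trig_mem le_rfl)
  exact (hS N (hpow N)).2.2

/-! ### Coefficients of Dirichlet series -/

section

/-- The `j`-th coefficient of a Dirichlet series `∑ a_L e^{-2Lm}` in terms of its values and of the
coefficients before it. -/
theorem tendsto_dirichlet_coeff {a : ℕ → ℝ} {S : ℕ → ℝ}
    (h : ∀ m : ℕ, 1 ≤ m → HasSum (fun L : ℕ => Real.exp (-(2 * (L : ℝ)) * m) * a L) (S m)) (j : ℕ) :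
    Tendsto (fun m : ℕ => Real.exp (2 * (j : ℝ) * m) *
      (S m - ∑ L ∈ Finset.range j, Real.exp (-(2 * (L : ℝ)) * m) * a L)) atTop (𝓝 (a j)) := by
  have hlim : Tendsto (fun m : ℕ => ∑' L : ℕ, Real.exp (-(2 * (L : ℝ)) * m) * a (L + j)) atTop
      (𝓝 (∑' L : ℕ, if L = 0 then a j else 0)) := by
    refine tendsto_tsum_of_dominated_convergence
      (bound := fun L : ℕ => |Real.exp (-(2 * (L : ℝ)) * (1 : ℕ)) * a (L + j)|) ?_ ?_ ?_
    · have h1 := ((summable_nat_add_iff j).2 (h 1 le_rfl).summable).mul_left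
        (Real.exp (2 * j))
      refine h1.abs.congr fun L => ?_
      rw [← mul_assoc, ← Real.exp_add]
      congr 3
      push_cast
      ring
    · intro L
      split_ifs with hL
      · simp [hL]
      · rw [← zero_mul (a (L + j))]
        refine Tendsto.mul_const _ ?_
        have hL' : (0 : ℝ) < L := by exact_mod_cast Nat.pos_of_ne_zero hL
        refine Real.tendsto_exp_atBot.comp ?_
        exact Tendsto.const_mul_atTop_of_neg (by linarith) tendsto_natCast_atTop_atTop
    · filter_upwards [eventually_ge_atTop 1] with m hm L
      rw [Real.norm_eq_abs, abs_mul, abs_mul]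
      refine mul_le_mul_of_nonneg_right ?_ (abs_nonneg _)
      rw [Real.abs_exp, Real.abs_exp, Real.exp_le_exp]
      have : (1 : ℝ) ≤ m := by exact_mod_cast hm
      have : (0 : ℝ) ≤ L := by positivity
      push_cast
      nlinarith
  rw [tsum_ite_eq] at hlim
  refine hlim.congr' ?_
  filter_upwards [eventually_ge_atTop 1] with m hm
  have hs := h m hm
  rw [← hs.tsum_eq, ← hs.summable.sum_add_tsum_nat_add j, add_sub_cancel_left, ← tsum_mul_left]
  refine tsum_congr fun L => ?_
  rw [← mul_assoc, ← Real.exp_add]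
  congr 2
  push_cast
  ring

theorem dirichlet_unique {a b : ℕ → ℝ} {S : ℕ → ℝ}
    (ha : ∀ m : ℕ, 1 ≤ m → HasSum (fun L : ℕ => Real.exp (-(2 * (L : ℝ)) * m) * a L) (S m))
    (hb : ∀ m : ℕ, 1 ≤ m → HasSum (fun L : ℕ => Real.exp (-(2 * (L : ℝ)) * m) * b L) (S m))
    (j : ℕ) : a j = b j := by
  induction j using Nat.strong_induction_on with
  | _ j ih =>
    refine tendsto_nhds_unique (tendsto_dirichlet_coeff ha j) ?_
    have := tendsto_dirichlet_coeff hb j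
    have e : ∀ m : ℕ, ∑ L ∈ Finset.range j, Real.exp (-(2 * (L : ℝ)) * m) * a L =
        ∑ L ∈ Finset.range j, Real.exp (-(2 * (L : ℝ)) * m) * b L := fun m =>
      Finset.sum_congr rfl fun L hL => by rw [ih L (Finset.mem_range.1 hL)]
    simpa only [e] using this

/-! ### The layer kernels of a Hopf heat space -/

/-- The kernel `f_L(x, y)` on the space `M`. -/
noncomputable def layerKernel {M : Type*} (r θ : M → M → ℝ) (L : ℕ) (x y : M) : ℝ :=
  layer L (Real.cos (r x y)) (θ x y)

variable {M : Type*} [TopologicalSpace M] [MeasurableSpace M] {r θ : M → M → ℝ} {μ : Measure M}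

namespace IsHopfHeatSpace

theorem cos_nonneg (hM : IsHopfHeatSpace r θ μ) (x y : M) : 0 ≤ Real.cos (r x y) :=
  Real.cos_nonneg_of_neg_pi_div_two_le_of_le (by linarith [hM.r_nonneg x y, Real.pi_pos])
    (hM.r_le x y)

theorem layerKernel_symm (hM : IsHopfHeatSpace r θ μ) (L : ℕ) (x y : M) :
    layerKernel r θ L x y = layerKernel r θ L y x := by
  rw [layerKernel, layerKernel, hM.r_symm, hM.θ_symm]

theorem kernel_symm (hM : IsHopfHeatSpace r θ μ) (t : ℝ) (x y : M) :
    kernel r θ t x y = kernel r θ t y x := by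
  rw [kernel, kernel, hM.r_symm, hM.θ_symm]

theorem abs_layerKernel_le (hM : IsHopfHeatSpace r θ μ) (L : ℕ) (x y : M) :
    |layerKernel r θ L x y| ≤ mult L :=
  abs_layer_le L (hM.cos_nonneg x y) (Real.cos_le_one _) _

theorem layerKernel_self (hM : IsHopfHeatSpace r θ μ) (L : ℕ) (x : M) :
    layerKernel r θ L x x = mult L := by
  rw [layerKernel, hM.r_self, hM.θ_self, Real.cos_zero, layer_one_zero]

theorem hasSum_kernel (hM : IsHopfHeatSpace r θ μ) {t : ℝ} (ht : 0 < t) (x y : M) :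
    HasSum (fun L : ℕ => Real.exp (-(2 * (L : ℝ)) * t) * layerKernel r θ L x y)
      (kernel r θ t x y) :=
  hasSum_kernelSeries ht (hM.cos_nonneg x y) _

/-- Although `max r θ` need not be a metric, its sublevel sets generate the neighbourhoods; in
particular these are countably generated. -/
theorem nhds_eq_comap (hM : IsHopfHeatSpace r θ μ) (x : M) :
    𝓝 x = comap (fun y => max (r x y) (θ x y)) (𝓝 0) := by
  refine (hM.nhds_basis x).ext (Metric.nhds_basis_ball.comap _) ?_ ?_
  · intro ε hε
    refine ⟨ε, hε, fun y hy => ?_⟩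
    rw [Set.mem_preimage, mem_ball_zero_iff, Real.norm_eq_abs] at hy
    exact max_lt_iff.1 ((le_abs_self _).trans_lt hy)
  · intro ε hε
    refine ⟨ε, hε, fun y hy => ?_⟩
    rw [Set.mem_preimage, mem_ball_zero_iff, Real.norm_eq_abs,
      abs_of_nonneg ((hM.r_nonneg x y).trans (le_max_left _ _))]
    exact max_lt hy.1 hy.2

theorem firstCountableTopology (hM : IsHopfHeatSpace r θ μ) : FirstCountableTopology M :=
  ⟨fun x => by rw [hM.nhds_eq_comap x]; infer_instance⟩

theorem tendsto_r_nhds (hM : IsHopfHeatSpace r θ μ) (x : M) :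
    Tendsto (fun y => r x y) (𝓝 x) (𝓝 0) := by
  refine Metric.tendsto_nhds.2 fun ε hε => ?_
  filter_upwards [(hM.nhds_basis x).mem_of_mem hε] with y hy
  rw [Real.dist_eq, sub_zero, abs_of_nonneg (hM.r_nonneg x y)]
  exact hy.1

theorem continuous_r (hM : IsHopfHeatSpace r θ μ) : Continuous (Function.uncurry r) := by
  refine continuous_iff_continuousAt.2 fun ⟨x, y⟩ => ?_
  rw [ContinuousAt, tendsto_iff_dist_tendsto_zero]
  have h : Tendsto (fun z : M × M => r x z.1 + r y z.2) (𝓝 (x, y)) (𝓝 (0 + 0)) :=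
    ((hM.tendsto_r_nhds x).comp (continuous_fst.tendsto (x, y))).add
      ((hM.tendsto_r_nhds y).comp (continuous_snd.tendsto (x, y)))
  rw [add_zero] at h
  refine squeeze_zero (fun _ => dist_nonneg) (fun z => ?_) h
  have t1 := hM.r_triangle x z.1 y
  have t2 := hM.r_triangle z.1 z.2 y
  have t3 := hM.r_triangle z.1 x z.2
  have t4 := hM.r_triangle x y z.2
  have s1 := hM.r_symm x z.1
  have s2 := hM.r_symm y z.2
  rw [Real.dist_eq, abs_le]
  simp only [Function.uncurry]
  constructor <;> linarith

/-- Where `r = π/2`, the function `θ` may be discontinuous, but the terms with `n ≠ 0` tend to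
zero there. -/
theorem continuous_mode_comp (hM : IsHopfHeatSpace r θ μ) (q : ℤ × ℕ) :
    Continuous fun z : M × M => mode q (Real.cos (r z.1 z.2)) (θ z.1 z.2) := by
  have hr : Continuous fun z : M × M => Real.cos (r z.1 z.2) :=
    Real.continuous_cos.comp hM.continuous_r
  have hz : Continuous fun z : M × M => zern q.2 q.1.natAbs (Real.cos (r z.1 z.2)) :=
    (continuous_zern _ _).comp hr
  refine continuous_iff_continuousAt.2 fun z₀ => ?_
  by_cases hlt : r z₀.1 z₀.2 < Real.pi / 2
  · have ho : IsOpen {z : M × M | r z.1 z.2 < Real.pi / 2} :=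
      isOpen_lt hM.continuous_r continuous_const
    have hθ : ContinuousAt (fun z : M × M => θ z.1 z.2) z₀ :=
      hM.θ_continuous.continuousAt (ho.mem_nhds hlt)
    exact hz.continuousAt.mul (Real.continuous_cos.continuousAt.comp (hθ.const_mul (q.1 : ℝ)))
  · have hr0 : r z₀.1 z₀.2 = Real.pi / 2 := le_antisymm (hM.r_le _ _) (not_lt.1 hlt)
    by_cases hq : q.1 = 0
    · simpa [mode, hq] using hz.continuousAt
    · have h0 : zern q.2 q.1.natAbs (Real.cos (r z₀.1 z₀.2)) = 0 := by
        rw [hr0, Real.cos_pi_div_two, zern, zero_pow (Int.natAbs_ne_zero.2 hq), zero_mul]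
      rw [ContinuousAt, mode, h0, zero_mul]
      have hz0 := hz.continuousAt (x := z₀)
      rw [ContinuousAt, h0] at hz0
      refine squeeze_zero_norm (fun z => ?_) (tendsto_zero_iff_norm_tendsto_zero.1 hz0)
      rw [mode, norm_mul]
      exact mul_le_of_le_one_right (norm_nonneg _) (Real.abs_cos_le_one _)

theorem continuous_layerKernel (hM : IsHopfHeatSpace r θ μ) (L : ℕ) :
    Continuous fun z : M × M => layerKernel r θ L z.1 z.2 :=
  continuous_finsetSum _ fun q _ => (hM.continuous_mode_comp q).const_mul (weight q)

theorem continuous_layerKernel_right (hM : IsHopfHeatSpace r θ μ) (L : ℕ) (x : M) :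
    Continuous fun y => layerKernel r θ L x y :=
  (hM.continuous_layerKernel L).comp (f := fun y => (x, y)) (by fun_prop)

theorem continuous_layerKernel_left (hM : IsHopfHeatSpace r θ μ) (L : ℕ) (y : M) :
    Continuous fun x => layerKernel r θ L x y :=
  (hM.continuous_layerKernel L).comp (f := fun x => (x, y)) (by fun_prop)

theorem measurable_kernel_right (hM : IsHopfHeatSpace r θ μ) {t : ℝ} (ht : 0 < t) (x : M) :
    Measurable fun y => kernel r θ t x y :=
  (hM.heatKernel.measurable t ht).of_uncurry_left

theorem abs_kernel_le (hM : IsHopfHeatSpace r θ μ) {t : ℝ} (ht : 0 < t) (x y : M) :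
    |kernel r θ t x y| ≤ ∑' L : ℕ, mult L * Real.exp (-(2 * (L : ℝ)) * t) := by
  rw [← Real.norm_eq_abs, ← (hM.hasSum_kernel ht x y).tsum_eq]
  refine tsum_of_norm_bounded (summable_mult ht).hasSum fun L => ?_
  rw [Real.norm_eq_abs, abs_mul, Real.abs_exp, mul_comm]
  exact mul_le_mul_of_nonneg_right (hM.abs_layerKernel_le L x y) (Real.exp_pos _).le

/-- The kernel tends to `1` as `t → ∞`, so Fatou's lemma bounds the total mass. -/
theorem measure_univ_le_one [Nonempty M] [SigmaFinite μ] [μ.IsOpenPosMeasure]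
    (hM : IsHopfHeatSpace r θ μ) : μ Set.univ ≤ 1 := by
  have hne : NeBot (ae μ) := by
    rw [ae_neBot]
    intro h
    have := isOpen_univ.measure_ne_zero μ (Set.univ_nonempty (α := M))
    simp [h] at this
  have h1 : ∀ᵐ x ∂μ, ∀ n : ℕ, ∀ᵐ y ∂μ, 0 ≤ kernel r θ ((n + 1 : ℕ) : ℝ) x y :=
    ae_all_iff.2 fun n => Measure.ae_ae_of_ae_prod (hM.heatKernel.nonneg _ (by positivity))
  have h2 : ∀ᵐ x ∂μ, ∀ n : ℕ, Integrable (fun y => kernel r θ ((n + 1 : ℕ) : ℝ) x y) μ ∧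
      ∫ y, kernel r θ ((n + 1 : ℕ) : ℝ) x y ∂μ = 1 :=
    ae_all_iff.2 fun n => hM.heatKernel.conservative _ (by positivity)
  obtain ⟨x, hx1, hx2⟩ := (h1.and h2).exists
  have hlim : ∀ y, Tendsto (fun n : ℕ => kernel r θ ((n + 1 : ℕ) : ℝ) x y) atTop (𝓝 1) := by
    intro y
    have := tendsto_dirichlet_coeff (S := fun m : ℕ => kernel r θ (m : ℝ) x y)
      (fun m hm => hM.hasSum_kernel (by exact_mod_cast hm) x y) 0
    simp only [layerKernel, layer_zero] at this
    simpa [Function.comp_def] using this.comp (tendsto_add_atTop_nat 1)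
  have hint : ∀ n : ℕ, ∫⁻ y, ENNReal.ofReal (kernel r θ ((n + 1 : ℕ) : ℝ) x y) ∂μ = 1 := by
    intro n
    rw [← ofReal_integral_eq_lintegral_ofReal (hx2 n).1 (hx1 n), (hx2 n).2, ENNReal.ofReal_one]
  calc μ Set.univ = ∫⁻ y, 1 ∂μ := by simp
    _ = ∫⁻ y, liminf (fun n : ℕ => ENNReal.ofReal (kernel r θ ((n + 1 : ℕ) : ℝ) x y)) atTop ∂μ := by
      refine lintegral_congr fun y => ?_
      have := (ENNReal.continuous_ofReal.tendsto 1).comp (hlim y)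
      rw [ENNReal.ofReal_one] at this
      exact this.liminf_eq.symm
    _ ≤ liminf (fun n : ℕ => ∫⁻ y, ENNReal.ofReal (kernel r θ ((n + 1 : ℕ) : ℝ) x y) ∂μ) atTop :=
      lintegral_liminf_le fun n => (hM.measurable_kernel_right (by positivity) x).ennreal_ofReal
    _ = 1 := by simp only [hint, liminf_const]

theorem isFiniteMeasure [Nonempty M] [SigmaFinite μ] [μ.IsOpenPosMeasure]
    (hM : IsHopfHeatSpace r θ μ) : IsFiniteMeasure μ :=
  ⟨hM.measure_univ_le_one.trans_lt ENNReal.one_lt_top⟩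

theorem integrable_kernel_right [IsFiniteMeasure μ] (hM : IsHopfHeatSpace r θ μ) {t : ℝ}
    (ht : 0 < t) (x : M) : Integrable (fun y => kernel r θ t x y) μ :=
  Integrable.of_bound (hM.measurable_kernel_right ht x).aestronglyMeasurable _
    (Eventually.of_forall fun y => hM.abs_kernel_le ht x y)

variable [BorelSpace M]

theorem integrable_layerKernel_mul (hM : IsHopfHeatSpace r θ μ) (L : ℕ) (x : M) {g : M → ℝ}
    (hg : Integrable g μ) : Integrable (fun y => layerKernel r θ L x y * g y) μ :=
  hg.bdd_mul (hM.continuous_layerKernel_right L x).measurable.aestronglyMeasurable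
    (Eventually.of_forall fun y => hM.abs_layerKernel_le L x y)

theorem hasSum_integral_kernel_mul (hM : IsHopfHeatSpace r θ μ) {t : ℝ} (ht : 0 < t) (x : M)
    {g : M → ℝ} (hg : Integrable g μ) :
    HasSum (fun L : ℕ => Real.exp (-(2 * (L : ℝ)) * t) * ∫ y, layerKernel r θ L x y * g y ∂μ)
      (∫ y, kernel r θ t x y * g y ∂μ) := by
  have h := hasSum_integral_of_summable_integral_norm (μ := μ)
    (F := fun (L : ℕ) y => Real.exp (-(2 * (L : ℝ)) * t) * (layerKernel r θ L x y * g y))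
    (fun L => (hM.integrable_layerKernel_mul L x hg).const_mul _) ?_
  · simp only [integral_const_mul] at h
    have e : ∀ y, ∑' L : ℕ, Real.exp (-(2 * (L : ℝ)) * t) * (layerKernel r θ L x y * g y) =
        kernel r θ t x y * g y := fun y => by
      simp only [← mul_assoc]
      rw [tsum_mul_right, (hM.hasSum_kernel ht x y).tsum_eq]
    simpa only [e] using h
  · refine Summable.of_nonneg_of_le (fun L => integral_nonneg fun y => norm_nonneg _) (fun L => ?_)
      ((summable_mult ht).mul_right (∫ y, ‖g y‖ ∂μ))
    rw [← integral_const_mul]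
    refine integral_mono_of_nonneg (Eventually.of_forall fun y => norm_nonneg _)
      (hg.norm.const_mul _) (Eventually.of_forall fun y => ?_)
    simp only [norm_mul, Real.norm_eq_abs, Real.abs_exp]
    rw [← mul_assoc, mul_comm (mult L)]
    gcongr
    exact hM.abs_layerKernel_le L x y

theorem continuous_integral_layerKernel_mul (hM : IsHopfHeatSpace r θ μ) (L : ℕ)
    {g : M → ℝ} (hg : Integrable g μ) :
    Continuous fun x => ∫ y, layerKernel r θ L x y * g y ∂μ := by
  have := hM.firstCountableTopology
  refine continuous_of_dominated (bound := fun y => mult L * ‖g y‖)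
    (fun x => (hM.integrable_layerKernel_mul L x hg).aestronglyMeasurable)
    (fun x => Eventually.of_forall fun y => ?_) (hg.norm.const_mul _)
    (Eventually.of_forall fun y => (hM.continuous_layerKernel_left L y).mul_const _)
  rw [norm_mul]
  exact mul_le_mul_of_nonneg_right (hM.abs_layerKernel_le L x y) (norm_nonneg _)

theorem integrable_layerKernel [IsFiniteMeasure μ] (hM : IsHopfHeatSpace r θ μ) (L : ℕ) (x : M) :
    Integrable (fun y => layerKernel r θ L x y) μ := by
  simpa using hM.integrable_layerKernel_mul L x (integrable_const (1 : ℝ))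

/-- Comparison of coefficients in `∫ p_t(x, y) dμ(y) = 1`. It holds for almost all `x`, hence for
all `x` by continuity. -/
theorem integral_layerKernel [IsFiniteMeasure μ] [μ.IsOpenPosMeasure]
    (hM : IsHopfHeatSpace r θ μ) (L : ℕ) (x : M) :
    ∫ y, layerKernel r θ L x y ∂μ = if L = 0 then 1 else 0 := by
  have h2 : ∀ᵐ x ∂μ, ∀ n : ℕ, 1 ≤ n → ∫ y, kernel r θ (n : ℝ) x y ∂μ = 1 := by
    refine ae_all_iff.2 fun n => ?_
    by_cases hn : 1 ≤ n
    · filter_upwards [hM.heatKernel.conservative (n : ℝ) (by exact_mod_cast hn)] with x hx _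
      exact hx.2
    · exact Eventually.of_forall fun x hx => absurd hx hn
  have h3 : (fun x => ∫ y, layerKernel r θ L x y ∂μ) =ᵐ[μ] fun _ => if L = 0 then 1 else 0 := by
    filter_upwards [h2] with x hx
    refine dirichlet_unique (a := fun L => ∫ y, layerKernel r θ L x y ∂μ)
      (b := fun L => if L = 0 then 1 else 0) (S := fun _ => 1) (fun m hm => ?_) (fun m _ => ?_) L
    · have := hM.hasSum_integral_kernel_mul (t := m) (by exact_mod_cast hm) x
        (integrable_const (1 : ℝ))
      simpa [hx m hm] using this
    · refine (hasSum_ite_eq 0 (1 : ℝ)).congr_fun fun L => ?_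
      split_ifs with hL <;> simp [hL]
  have h4 : Continuous fun x => ∫ y, layerKernel r θ L x y ∂μ := by
    simpa using hM.continuous_integral_layerKernel_mul L (integrable_const (1 : ℝ))
  exact congrFun (Measure.eq_of_ae_eq h3 h4 continuous_const) x

theorem isProbabilityMeasure [Nonempty M] [IsFiniteMeasure μ] [μ.IsOpenPosMeasure]
    (hM : IsHopfHeatSpace r θ μ) : IsProbabilityMeasure μ := by
  obtain ⟨x⟩ := ‹Nonempty M›
  have h := hM.integral_layerKernel 0 x
  simp only [layerKernel, layer_zero, if_true, integral_const, smul_eq_mul, mul_one] at h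
  exact ⟨(ENNReal.toReal_eq_one_iff _).1 h⟩

/-- Comparison of coefficients, in `s` and then in `t`, in the semigroup law. It holds for almost
all `(x, z)`, hence for all `(x, z)` by continuity. -/
theorem integral_layerKernel_mul_layerKernel [IsFiniteMeasure μ] [μ.IsOpenPosMeasure]
    (hM : IsHopfHeatSpace r θ μ) (L L' : ℕ) (x z : M) :
    ∫ y, layerKernel r θ L x y * layerKernel r θ L' z y ∂μ =
      if L' = L then layerKernel r θ L x z else 0 := by
  have h : ∀ᵐ p ∂(μ.prod μ), ∀ s t : ℕ, 1 ≤ s → 1 ≤ t →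
      kernel r θ ((s : ℝ) + t) p.1 p.2 = ∫ w, kernel r θ s p.1 w * kernel r θ t w p.2 ∂μ := by
    refine ae_all_iff.2 fun s => ae_all_iff.2 fun t => ?_
    by_cases hs : 1 ≤ s
    · by_cases ht : 1 ≤ t
      · filter_upwards [hM.heatKernel.semigroup s t (by exact_mod_cast hs) (by exact_mod_cast ht)]
          with p hp _ _
        exact hp.2
      · exact Eventually.of_forall fun x _ hx => absurd hx ht
    · exact Eventually.of_forall fun x hx => absurd hx hs
  have h1 : (fun p : M × M => ∫ y, layerKernel r θ L p.1 y * layerKernel r θ L' p.2 y ∂μ)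
      =ᵐ[μ.prod μ] fun p => if L' = L then layerKernel r θ L p.1 p.2 else 0 := by
    filter_upwards [h] with p hp
    -- coefficients of the series in `s`
    have hstep : ∀ t : ℕ, 1 ≤ t → ∫ w, layerKernel r θ L p.1 w * kernel r θ t p.2 w ∂μ =
        Real.exp (-(2 * (L : ℝ)) * t) * layerKernel r θ L p.1 p.2 := by
      intro t ht
      have ht0 : (0 : ℝ) < t := by exact_mod_cast ht
      refine dirichlet_unique (a := fun L => ∫ w, layerKernel r θ L p.1 w * kernel r θ t p.2 w ∂μ)
        (b := fun L => Real.exp (-(2 * (L : ℝ)) * t) * layerKernel r θ L p.1 p.2)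
        (S := fun s => kernel r θ ((s : ℝ) + t) p.1 p.2) (fun s hs => ?_) (fun s hs => ?_) L
      · have hs0 : (0 : ℝ) < s := by exact_mod_cast hs
        rw [hp s t hs ht]
        have := hM.hasSum_integral_kernel_mul hs0 p.1 (hM.integrable_kernel_right ht0 p.2)
        simpa only [hM.kernel_symm t _ p.2] using this
      · have hs0 : (0 : ℝ) < s := by exact_mod_cast hs
        refine (hM.hasSum_kernel (add_pos hs0 ht0) p.1 p.2).congr_fun fun L => ?_
        rw [← mul_assoc, ← Real.exp_add, mul_add]
    refine dirichlet_unique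
      (a := fun L' => ∫ y, layerKernel r θ L p.1 y * layerKernel r θ L' p.2 y ∂μ)
      (b := fun L' => if L' = L then layerKernel r θ L p.1 p.2 else 0)
      (S := fun t => Real.exp (-(2 * (L : ℝ)) * t) * layerKernel r θ L p.1 p.2)
      (fun t ht => ?_) (fun t _ => ?_) L'
    · have ht0 : (0 : ℝ) < t := by exact_mod_cast ht
      have := hM.hasSum_integral_kernel_mul ht0 p.2 (hM.integrable_layerKernel L p.1)
      simp only [mul_comm _ (layerKernel r θ L p.1 _)] at this
      rwa [hstep t ht] at this
    · refine (hasSum_ite_eq L (Real.exp (-(2 * (L : ℝ)) * t) *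
        layerKernel r θ L p.1 p.2)).congr_fun fun L' => ?_
      split_ifs with hL <;> simp [hL]
  have := hM.firstCountableTopology
  have hc : Continuous fun p : M × M =>
      ∫ y, layerKernel r θ L p.1 y * layerKernel r θ L' p.2 y ∂μ := by
    refine continuous_of_dominated (bound := fun y => mult L * mult L')
      (fun p => ((hM.continuous_layerKernel_right L p.1).mul
        (hM.continuous_layerKernel_right L' p.2)).measurable.aestronglyMeasurable)
      (fun p => Eventually.of_forall fun y => ?_) (integrable_const _)
      (Eventually.of_forall fun y => ?_)
    · rw [norm_mul]
      exact mul_le_mul (hM.abs_layerKernel_le L _ y) (hM.abs_layerKernel_le L' _ y) (norm_nonneg _)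
        (mult_nonneg L)
    · exact ((hM.continuous_layerKernel_left L y).comp continuous_fst).mul
        ((hM.continuous_layerKernel_left L' y).comp continuous_snd)
  have hc' : Continuous fun p : M × M => if L' = L then layerKernel r θ L p.1 p.2 else 0 := by
    split_ifs
    · exact hM.continuous_layerKernel L
    · exact continuous_const
  exact congrFun (Measure.eq_of_ae_eq h1 hc hc') (x, z)

end IsHopfHeatSpace

end

/-! ### The eigenspace as a reproducing kernel space -/

section

theorem tendsto_exp_sub_one_div (a : ℝ) :
    Tendsto (fun t : ℝ => (Real.exp (a * t) - 1) / t) (𝓝[>] 0) (𝓝 a) := by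
  have h : HasDerivAt (fun t : ℝ => Real.exp (a * t)) a 0 := by
    have := ((hasDerivAt_id (0 : ℝ)).const_mul a).exp
    simpa using this
  have h2 := (hasDerivAt_iff_tendsto_slope_zero.1 h).mono_left
    (nhdsWithin_mono 0 fun t (ht : 0 < t) => ht.ne')
  refine h2.congr fun t => ?_
  simp [div_eq_inv_mul]

variable {M : Type*} [TopologicalSpace M] [MeasurableSpace M] {r θ : M → M → ℝ} {μ : Measure M}
  [BorelSpace M]

namespace IsHopfHeatSpace

theorem memLp_layerKernel [IsFiniteMeasure μ] (hM : IsHopfHeatSpace r θ μ) (L : ℕ) (x : M) :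
    MemLp (fun y => layerKernel r θ L x y) 2 μ :=
  MemLp.of_bound (hM.continuous_layerKernel_right L x).measurable.aestronglyMeasurable (mult L)
    (Eventually.of_forall fun y => hM.abs_layerKernel_le L x y)

/-- The class of `f_1(x, ·)` in `L²(μ)`, which represents the evaluation at `x` on `E_{0,1}`. -/
noncomputable def evalVec [IsFiniteMeasure μ] (hM : IsHopfHeatSpace r θ μ) (x : M) : Lp ℝ 2 μ :=
  (hM.memLp_layerKernel 1 x).toLp

theorem coeFn_evalVec [IsFiniteMeasure μ] (hM : IsHopfHeatSpace r θ μ) (x : M) :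
    hM.evalVec x =ᵐ[μ] fun y => layerKernel r θ 1 x y :=
  MemLp.coeFn_toLp _

theorem inner_evalVec_left [IsFiniteMeasure μ] (hM : IsHopfHeatSpace r θ μ) (x : M)
    (f : Lp ℝ 2 μ) : inner ℝ (hM.evalVec x) f = ∫ y, layerKernel r θ 1 x y * f y ∂μ := by
  rw [L2.inner_def]
  refine integral_congr_ae ?_
  filter_upwards [hM.coeFn_evalVec x] with y hy
  simp [hy, mul_comm]

theorem inner_evalVec_evalVec [IsFiniteMeasure μ] [μ.IsOpenPosMeasure]
    (hM : IsHopfHeatSpace r θ μ) (x y : M) : inner ℝ (hM.evalVec x) (hM.evalVec y) =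
      4 * (Real.cos (r x y) * Real.cos (θ x y)) := by
  rw [inner_evalVec_left, ← layer_one, ← layerKernel]
  have h := hM.integral_layerKernel_mul_layerKernel 1 1 x y
  rw [if_pos rfl] at h
  rw [← h]
  refine integral_congr_ae ?_
  filter_upwards [hM.coeFn_evalVec y] with z hz
  rw [hz]

theorem continuous_inner_evalVec [IsFiniteMeasure μ] (hM : IsHopfHeatSpace r θ μ)
    (f : Lp ℝ 2 μ) : Continuous fun x => inner ℝ (hM.evalVec x) f := by
  simp only [inner_evalVec_left]
  exact hM.continuous_integral_layerKernel_mul 1 ((Lp.memLp f).integrable one_le_two)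

theorem integral_layerKernel_mul_kernel [IsFiniteMeasure μ] [μ.IsOpenPosMeasure]
    (hM : IsHopfHeatSpace r θ μ) (L : ℕ) {t : ℝ} (ht : 0 < t) (x z : M) :
    ∫ y, kernel r θ t z y * layerKernel r θ L x y ∂μ =
      Real.exp (-(2 * (L : ℝ)) * t) * layerKernel r θ L x z := by
  refine (hM.hasSum_integral_kernel_mul ht z (hM.integrable_layerKernel L x)).unique ?_
  refine (hasSum_ite_eq L (Real.exp (-(2 * (L : ℝ)) * t) *
    layerKernel r θ L x z)).congr_fun fun L' => ?_
  rw [hM.integral_layerKernel_mul_layerKernel]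
  by_cases h : L = L'
  · simp [h, hM.layerKernel_symm L' z x]
  · simp [h, Ne.symm h]

theorem evalVec_mem [IsFiniteMeasure μ] [μ.IsOpenPosMeasure] (hM : IsHopfHeatSpace r θ μ) (x : M) :
    hM.evalVec x ∈ E01 r θ μ := by
  have hK := hM.coeFn_evalVec x
  have hheat : ∀ t, 0 < t → heatOp μ (kernel r θ) t (hM.evalVec x) =
      fun y => Real.exp (-2 * t) * layerKernel r θ 1 x y := by
    intro t ht
    rw [heatOp_congr hK]
    funext y
    have := hM.integral_layerKernel_mul_kernel 1 ht x y
    simpa [heatOp] using this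
  refine ⟨fun t ht => Eventually.of_forall fun y => ?_, fun t ht => ?_, ?_⟩
  · refine Integrable.bdd_mul (c := ∑' L : ℕ, mult L * Real.exp (-(2 * (L : ℝ)) * t))
      ((Lp.memLp _).integrable one_le_two)
      (hM.measurable_kernel_right ht y).aestronglyMeasurable
      (Eventually.of_forall fun z => hM.abs_kernel_le ht y z)
  · rw [hheat t ht]
    exact (hM.memLp_layerKernel 1 x).const_mul _
  · have hc : Tendsto (fun t : ℝ => ‖(Real.exp (-2 * t) - 1) / t - lam 0 1‖ₑ *
        eLpNorm (fun y => layerKernel r θ 1 x y) 2 μ) (𝓝[>] 0) (𝓝 0) := by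
      have h1 : Tendsto (fun t : ℝ => (Real.exp (-2 * t) - 1) / t - lam 0 1) (𝓝[>] 0) (𝓝 0) := by
        have := (tendsto_exp_sub_one_div (-2)).sub_const (lam 0 1)
        have hl : (-2 : ℝ) - lam 0 1 = 0 := by simp [lam]
        rwa [hl] at this
      have h2 := ENNReal.Tendsto.mul_const (b := eLpNorm (fun y => layerKernel r θ 1 x y) 2 μ)
        h1.enorm (Or.inr (hM.memLp_layerKernel 1 x).eLpNorm_ne_top)
      simpa using h2
    refine hc.congr' ?_
    filter_upwards [self_mem_nhdsWithin] with t ht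
    rw [← eLpNorm_const_smul, hheat t ht]
    refine eLpNorm_congr_ae ?_
    filter_upwards [hK, Lp.coeFn_smul (lam 0 1) (hM.evalVec x)] with y hy hy'
    simp only [hy', hy, Pi.smul_apply, smul_eq_mul]
    ring

/-- `f_L` is an eigenfunction of the symmetric operator `P_t`. -/
theorem integral_layerKernel_mul_heatOp [IsFiniteMeasure μ] [μ.IsOpenPosMeasure]
    (hM : IsHopfHeatSpace r θ μ) (L : ℕ) {t : ℝ} (ht : 0 < t) (x : M) {f : M → ℝ}
    (hf : Integrable f μ) : ∫ y, layerKernel r θ L x y * heatOp μ (kernel r θ) t f y ∂μ =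
      Real.exp (-(2 * (L : ℝ)) * t) * ∫ y, layerKernel r θ L x y * f y ∂μ := by
  have hint : Integrable (Function.uncurry fun y z =>
      layerKernel r θ L x y * (kernel r θ t y z * f z)) (μ.prod μ) := by
    have h1 : Integrable (fun p : M × M => f p.2) (μ.prod μ) := hf.comp_snd μ
    have h2 : Integrable (fun p : M × M => kernel r θ t p.1 p.2 * f p.2) (μ.prod μ) :=
      h1.bdd_mul (c := ∑' L : ℕ, mult L * Real.exp (-(2 * (L : ℝ)) * t))
        (hM.heatKernel.measurable t ht).aestronglyMeasurable
        (Eventually.of_forall fun p => hM.abs_kernel_le ht p.1 p.2)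
    exact h2.bdd_mul (c := mult L)
      ((hM.continuous_layerKernel_right L x).measurable.comp measurable_fst).aestronglyMeasurable
      (Eventually.of_forall fun p => hM.abs_layerKernel_le L x p.1)
  calc ∫ y, layerKernel r θ L x y * heatOp μ (kernel r θ) t f y ∂μ
      = ∫ y, ∫ z, layerKernel r θ L x y * (kernel r θ t y z * f z) ∂μ ∂μ := by
        simp only [heatOp, integral_const_mul]
    _ = ∫ z, ∫ y, layerKernel r θ L x y * (kernel r θ t y z * f z) ∂μ ∂μ :=
        integral_integral_swap hint
    _ = ∫ z, Real.exp (-(2 * (L : ℝ)) * t) * (layerKernel r θ L x z * f z) ∂μ := by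
        refine integral_congr_ae (Eventually.of_forall fun z => ?_)
        simp only
        rw [← mul_assoc, ← hM.integral_layerKernel_mul_kernel L ht x z, ← integral_mul_const]
        refine integral_congr_ae (Eventually.of_forall fun y => ?_)
        simp only
        rw [hM.kernel_symm t z y]
        ring
    _ = _ := integral_const_mul _ _

/-- Eigenfunctions for different eigenvalues are orthogonal: the generator, tested against
`f_L(x, ·)`, acts as `-2L` and as `-2`. -/
theorem integral_layerKernel_mul_eq_zero [IsProbabilityMeasure μ] [μ.IsOpenPosMeasure]
    (hM : IsHopfHeatSpace r θ μ) {f : Lp ℝ 2 μ} (hf : f ∈ E01 r θ μ) {L : ℕ} (hL : L ≠ 1) (x : M) :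
    ∫ y, layerKernel r θ L x y * f y ∂μ = 0 := by
  have hf' : IsGenerator μ (kernel r θ) f (lam 0 1 • f) := hf
  have hfi : Integrable f μ := (Lp.memLp f).integrable one_le_two
  have hgi : Integrable (lam 0 1 • f : Lp ℝ 2 μ) μ := (Lp.memLp _).integrable one_le_two
  set c := ∫ y, layerKernel r θ L x y * f y ∂μ with hc
  have hg : ∫ y, layerKernel r θ L x y * (lam 0 1 • f : Lp ℝ 2 μ) y ∂μ = lam 0 1 * c := by
    rw [hc, ← integral_const_mul]
    refine integral_congr_ae ?_
    filter_upwards [Lp.coeFn_smul (lam 0 1) f] with y hy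
    simp only [hy, Pi.smul_apply, smul_eq_mul]
    ring
  have hlim1 : Tendsto (fun t : ℝ => ((Real.exp (-(2 * (L : ℝ)) * t) - 1) / t - lam 0 1) * c)
      (𝓝[>] 0) (𝓝 ((-(2 * (L : ℝ)) - lam 0 1) * c)) :=
    ((tendsto_exp_sub_one_div _).sub_const _).mul_const _
  have hlim2 : Tendsto (fun t : ℝ => ((Real.exp (-(2 * (L : ℝ)) * t) - 1) / t - lam 0 1) * c)
      (𝓝[>] 0) (𝓝 0) := by
    have hz := ((ENNReal.tendsto_toReal ENNReal.zero_ne_top).comp hf'.tendsto).const_mul (mult L)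
    rw [ENNReal.toReal_zero, mul_zero] at hz
    refine squeeze_zero_norm' ?_ hz
    filter_upwards [self_mem_nhdsWithin] with t ht
    have hP := hf'.memLp t ht
    have hPi := hP.integrable one_le_two
    have hm : MemLp (fun y => (heatOp μ (kernel r θ) t f y - f y) / t -
        (lam 0 1 • f : Lp ℝ 2 μ) y) 2 μ := by
      have := ((hP.sub (Lp.memLp f)).const_mul t⁻¹).sub (Lp.memLp (lam 0 1 • f))
      refine this.ae_eq (Eventually.of_forall fun y => ?_)
      simp [div_eq_inv_mul]
    have e : ((Real.exp (-(2 * (L : ℝ)) * t) - 1) / t - lam 0 1) * c =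
        ∫ y, layerKernel r θ L x y * ((heatOp μ (kernel r θ) t f y - f y) / t -
          (lam 0 1 • f : Lp ℝ 2 μ) y) ∂μ := by
      have e1 : ∀ y, layerKernel r θ L x y * ((heatOp μ (kernel r θ) t f y - f y) / t -
          (lam 0 1 • f : Lp ℝ 2 μ) y) = (layerKernel r θ L x y * heatOp μ (kernel r θ) t f y -
          layerKernel r θ L x y * f y) / t - layerKernel r θ L x y * (lam 0 1 • f : Lp ℝ 2 μ) y :=
        fun y => by ring
      simp only [e1]
      have i1 := hM.integrable_layerKernel_mul L x hPi
      have i2 := hM.integrable_layerKernel_mul L x hfi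
      have i12 : Integrable (fun y => (layerKernel r θ L x y * heatOp μ (kernel r θ) t f y -
          layerKernel r θ L x y * f y) / t) μ := (i1.sub i2).div_const t
      rw [integral_sub i12 (hM.integrable_layerKernel_mul L x hgi),
        integral_div, integral_sub i1 i2, hM.integral_layerKernel_mul_heatOp L ht x hfi, hg]
      ring
    rw [e]
    calc _ ≤ ∫ y, mult L * ‖(heatOp μ (kernel r θ) t f y - f y) / t -
          (lam 0 1 • f : Lp ℝ 2 μ) y‖ ∂μ := by
          refine norm_integral_le_of_norm_le ((hm.integrable one_le_two).norm.const_mul _)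
            (Eventually.of_forall fun y => ?_)
          rw [norm_mul]
          exact mul_le_mul_of_nonneg_right (hM.abs_layerKernel_le L x y) (norm_nonneg _)
      _ ≤ _ := by
          rw [integral_const_mul]
          refine mul_le_mul_of_nonneg_left ?_ (mult_nonneg L)
          rw [integral_norm_eq_lintegral_enorm hm.aestronglyMeasurable,
            ← eLpNorm_one_eq_lintegral_enorm]
          exact ENNReal.toReal_mono hm.eLpNorm_ne_top
            (eLpNorm_le_eLpNorm_of_exponent_le one_le_two hm.aestronglyMeasurable)
  have h := tendsto_nhds_unique hlim1 hlim2
  refine (mul_eq_zero.1 h).resolve_left fun h0 => hL ?_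
  have : (L : ℝ) = 1 := by
    simp [lam] at h0
    linarith
  exact_mod_cast this

/-- The reproducing property. For an eigenfunction `f`, only the term `L = 1` of `P_t f` is left,
so that `P_t f = e^{-2t} ⟨f_1(x, ·), f⟩`; then `t → 0+`. -/
theorem coeFn_eq_inner_evalVec [IsProbabilityMeasure μ] [μ.IsOpenPosMeasure]
    (hM : IsHopfHeatSpace r θ μ) {f : Lp ℝ 2 μ} (hf : f ∈ E01 r θ μ) :
    f =ᵐ[μ] fun x => inner ℝ (hM.evalVec x) f := by
  have hfi : Integrable f μ := (Lp.memLp f).integrable one_le_two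
  set h : M → ℝ := fun x => inner ℝ (hM.evalVec x) f with hh
  have hcont : Continuous h := hM.continuous_inner_evalVec f
  have hmem : MemLp h 2 μ := by
    refine MemLp.of_bound hcont.measurable.aestronglyMeasurable (2 * ‖f‖)
      (Eventually.of_forall fun x => (norm_inner_le_norm _ _).trans ?_)
    refine mul_le_mul_of_nonneg_right (le_of_eq ?_) (norm_nonneg _)
    rw [@norm_eq_sqrt_real_inner, inner_evalVec_evalVec, hM.r_self, hM.θ_self]
    rw [Real.cos_zero, Real.sqrt_eq_iff_mul_self_eq] <;> norm_num
  have hheat : ∀ t, 0 < t → ∀ x, ∫ y, kernel r θ t x y * f y ∂μ = Real.exp (-2 * t) * h x := by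
    intro t ht x
    refine (hM.hasSum_integral_kernel_mul ht x hfi).unique ?_
    refine (hasSum_ite_eq 1 (Real.exp (-2 * t) * h x)).congr_fun fun L => ?_
    split_ifs with hL
    · rw [hL, hh]
      simp [inner_evalVec_left]
    · rw [hM.integral_layerKernel_mul_eq_zero hf hL, mul_zero]
  have happ := hM.heatKernel.approx_id f (Lp.memLp f)
  have hsmall : Tendsto (fun t : ℝ => ‖1 - Real.exp (-2 * t)‖ₑ * eLpNorm h 2 μ) (𝓝[>] 0) (𝓝 0) := by
    have h1 : Tendsto (fun t : ℝ => 1 - Real.exp (-2 * t)) (𝓝[>] 0) (𝓝 0) := by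
      have : Continuous fun t : ℝ => 1 - Real.exp (-2 * t) := by fun_prop
      have := (this.tendsto 0).mono_left (nhdsWithin_le_nhds (s := Set.Ioi 0))
      simpa using this
    have h2 := ENNReal.Tendsto.mul_const (b := eLpNorm h 2 μ) h1.enorm (Or.inr hmem.eLpNorm_ne_top)
    simpa using h2
  have hzero : eLpNorm (h - (f : M → ℝ)) 2 μ = 0 := by
    have hs := hsmall.add happ
    rw [add_zero] at hs
    refine le_antisymm (ge_of_tendsto hs ?_) zero_le
    filter_upwards [self_mem_nhdsWithin] with t ht
    rw [← eLpNorm_const_smul]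
    simp only [hheat t ht]
    refine le_trans (le_of_eq ?_) (eLpNorm_add_le (hmem.const_smul _).aestronglyMeasurable
      ((hmem.const_mul (Real.exp (-2 * t))).sub (Lp.memLp f)).aestronglyMeasurable one_le_two)
    congr 1
    funext x
    simp
    ring
  rw [eLpNorm_eq_zero_iff (hmem.sub (Lp.memLp f)).aestronglyMeasurable (by norm_num)] at hzero
  filter_upwards [hzero] with x hx
  exact (sub_eq_zero.1 hx).symm

end IsHopfHeatSpace

end

/-! ### Moments on the unit sphere of four-dimensional Euclidean space -/

/-- The `N`-th moment of the (not normalised) Gaussian weight on the line. -/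
noncomputable def gaussMoment (N : ℕ) : ℝ := ∫ t : ℝ, t ^ N * Real.exp (-(1 / 2) * t ^ 2)

theorem integrable_pow_mul_gauss (N : ℕ) :
    Integrable fun t : ℝ => t ^ N * Real.exp (-(1 / 2) * t ^ 2) := by
  have := integrable_rpow_mul_exp_neg_mul_sq (b := 1 / 2) (by norm_num) (s := N)
    (by have : (0 : ℝ) ≤ N := by positivity
        linarith)
  simpa only [Real.rpow_natCast] using this

theorem hasDerivAt_pow_mul_gauss (N : ℕ) (t : ℝ) :
    HasDerivAt (fun t : ℝ => t ^ (N + 1) * Real.exp (-(1 / 2) * t ^ 2))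
      (((N : ℝ) + 1) * (t ^ N * Real.exp (-(1 / 2) * t ^ 2)) -
        t ^ (N + 2) * Real.exp (-(1 / 2) * t ^ 2)) t := by
  have h1 := hasDerivAt_pow (N + 1) t
  have h2 := ((hasDerivAt_pow 2 t).const_mul (-(1 / 2) : ℝ)).exp
  refine (h1.mul h2).congr_deriv ?_
  push_cast
  ring

/-- Integration by parts. -/
theorem gaussMoment_add_two (N : ℕ) : gaussMoment (N + 2) = ((N : ℝ) + 1) * gaussMoment N := by
  have h := integral_eq_zero_of_hasDerivAt_of_integrable (hasDerivAt_pow_mul_gauss N)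
    (((integrable_pow_mul_gauss N).const_mul _).sub (integrable_pow_mul_gauss (N + 2)))
    (integrable_pow_mul_gauss (N + 1))
  rw [integral_sub ((integrable_pow_mul_gauss N).const_mul _) (integrable_pow_mul_gauss (N + 2)),
    integral_const_mul] at h
  rw [gaussMoment, gaussMoment]
  linarith

theorem gaussMoment_one : gaussMoment 1 = 0 := by
  have h := integral_neg_eq_self (fun t : ℝ => t ^ 1 * Real.exp (-(1 / 2) * t ^ 2)) volume
  simp only [pow_one, neg_sq, neg_mul, integral_neg] at h
  simp only [gaussMoment, pow_one, neg_mul]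
  linarith

theorem integral_Ioi_pow_add_two_mul_gauss (N : ℕ) :
    ∫ t in Set.Ioi (0 : ℝ), t ^ (N + 2) * Real.exp (-(1 / 2) * t ^ 2) =
      ((N : ℝ) + 1) * ∫ t in Set.Ioi (0 : ℝ), t ^ N * Real.exp (-(1 / 2) * t ^ 2) := by
  have hi := fun N => (integrable_pow_mul_gauss N).integrableOn (s := Set.Ioi 0)
  have h := integral_Ioi_of_hasDerivAt_of_tendsto' (a := 0) (m := 0)
    (fun t _ => hasDerivAt_pow_mul_gauss N t) (((hi N).const_mul _).sub (hi (N + 2))) ?_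
  · rw [integral_sub ((hi N).const_mul _) (hi (N + 2)), integral_const_mul] at h
    simp at h
    simp only [neg_mul, one_div] at *
    linarith
  · exact tendsto_zero_of_hasDerivAt_of_integrableOn_Ioi
      (fun t _ => hasDerivAt_pow_mul_gauss N t) (((hi N).const_mul _).sub (hi (N + 2))) (hi (N + 1))

/-- Euclidean space of dimension four. -/
abbrev E4 : Type := EuclideanSpace ℝ (Fin 4)

/-- The (not normalised) Gaussian weight on `E4`. It serves as a substitute for the uniform
measure of the sphere: its tensor moments are those of the sphere times `radialMoment`. -/
noncomputable def gaussWeight (g : E4) : ℝ := Real.exp (-(1 / 2) * ‖g‖ ^ 2)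

theorem continuous_gaussWeight : Continuous gaussWeight := by unfold gaussWeight; fun_prop

/-- The `N`-th moment of the norm for the Gaussian weight. -/
noncomputable def radialMoment (N : ℕ) : ℝ := ∫ g : E4, gaussWeight g * ‖g‖ ^ N

theorem integrable_gaussWeight_mul_norm_pow (N : ℕ) :
    Integrable fun g : E4 => gaussWeight g * ‖g‖ ^ N := by
  have h := (integrable_fun_norm_addHaar (volume : Measure E4)
    (f := fun t => Real.exp (-(1 / 2) * t ^ 2) * t ^ N)).2 ?_
  · exact h
  · refine ((integrable_pow_mul_gauss (N + 3)).integrableOn).congr_fun (fun t _ => ?_)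
      measurableSet_Ioi
    simp
    ring

theorem radialMoment_add_two (N : ℕ) :
    radialMoment (N + 2) = ((N : ℝ) + 4) * radialMoment N := by
  have h : ∀ N, radialMoment N = 4 * (volume.real (Metric.ball (0 : E4) 1) *
      ∫ t in Set.Ioi (0 : ℝ), t ^ (N + 3) * Real.exp (-(1 / 2) * t ^ 2)) := by
    intro N
    have h := integral_fun_norm_addHaar (volume : Measure E4)
      (fun t => Real.exp (-(1 / 2) * t ^ 2) * t ^ N)
    rw [radialMoment]
    refine h.trans ?_
    simp only [finrank_euclideanSpace, Fintype.card_fin, nsmul_eq_mul, smul_eq_mul]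
    push_cast
    congr 2
    refine setIntegral_congr_fun measurableSet_Ioi fun t _ => ?_
    ring
  rw [h, h, show N + 2 + 3 = (N + 3) + 2 by ring, integral_Ioi_pow_add_two_mul_gauss]
  push_cast
  ring

theorem radialMoment_pos (N : ℕ) : 0 < radialMoment N := by
  rw [radialMoment, integral_pos_iff_support_of_nonneg]
  · have : IsOpen {g : E4 | g ≠ 0} := isOpen_ne
    have hne : {g : E4 | g ≠ 0}.Nonempty := exists_ne 0
    refine (this.measure_pos volume hne).trans_le (measure_mono fun g hg => ?_)
    have : 0 < gaussWeight g := Real.exp_pos _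
    have : 0 < ‖g‖ := norm_pos_iff.2 hg
    exact (by positivity : (0 : ℝ) < gaussWeight g * ‖g‖ ^ N).ne'
  · exact fun g => mul_nonneg (Real.exp_pos _).le (by positivity)
  · exact integrable_gaussWeight_mul_norm_pow N

/-- The weight is a product over the coordinates. -/
theorem integral_inner_single_pow (N : ℕ) :
    ∫ g : E4, gaussWeight g * g 0 ^ N = gaussMoment N * gaussMoment 0 ^ 3 := by
  rw [← (PiLp.volume_preserving_toLp (Fin 4)).integral_comp
    (MeasurableEquiv.toLp 2 (Fin 4 → ℝ)).measurableEmbedding]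
  have h : ∀ y : Fin 4 → ℝ, gaussWeight (WithLp.toLp 2 y) * (WithLp.toLp 2 y : E4) 0 ^ N =
      ∏ i, (y i ^ (if i = 0 then N else 0) * Real.exp (-(1 / 2) * y i ^ 2)) := by
    intro y
    rw [gaussWeight, EuclideanSpace.norm_sq_eq, Finset.prod_mul_distrib, ← Real.exp_sum,
      Finset.mul_sum]
    simp
    ring
  simp only [h]
  rw [integral_fintype_prod_volume_eq_prod
    (fun (i : Fin 4) t => t ^ (if i = 0 then N else 0) * Real.exp (-(1 / 2) * t ^ 2))]
  simp only [Fin.prod_univ_four, gaussMoment]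
  simp
  ring

/-- By rotation invariance it is enough to consider the first coordinate. -/
theorem integral_inner_pow (a : E4) (N : ℕ) : ∫ g : E4, gaussWeight g * inner ℝ a g ^ N =
    ‖a‖ ^ N * (gaussMoment N * gaussMoment 0 ^ 3) := by
  set e : E4 := EuclideanSpace.single 0 ‖a‖
  have hn : ‖a‖ = ‖e‖ := by simp [e]
  set R : E4 ≃ₗᵢ[ℝ] E4 := (ℝ ∙ (a - e))ᗮ.reflection
  have hR : R a = e := Submodule.reflection_sub hn
  rw [← (R.symm.measurePreserving).integral_comp R.symm.toHomeomorph.measurableEmbedding]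
  have h : ∀ g : E4, gaussWeight (R.symm g) * inner ℝ a (R.symm g) ^ N =
      ‖a‖ ^ N * (gaussWeight g * g 0 ^ N) := by
    intro g
    rw [← R.inner_map_map, R.apply_symm_apply, hR, gaussWeight, R.symm.norm_map, gaussWeight]
    simp only [e, EuclideanSpace.inner_single_left]
    simp [mul_pow]
    ring
  simp only [h]
  rw [integral_const_mul, integral_inner_single_pow]

/-- Both sides satisfy the same recursion of step two. -/
theorem diskMoment_eq_gauss (N : ℕ) :
    diskMoment N = gaussMoment N * gaussMoment 0 ^ 3 / radialMoment N := by
  have h0 : radialMoment 0 = gaussMoment 0 * gaussMoment 0 ^ 3 := by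
    rw [← integral_inner_single_pow, radialMoment]
    simp
  induction N using Nat.twoStepInduction with
  | zero => rw [diskMoment_zero, ← h0, div_self (radialMoment_pos 0).ne']
  | one => rw [diskMoment_one, gaussMoment_one]; simp
  | more N ih _ =>
    rw [diskMoment_add_two, ih, gaussMoment_add_two, radialMoment_add_two]
    have := (radialMoment_pos N).ne'
    field_simp

/-- The tensor, with `N` indices, of the moments of degree `N` of `Y` for the density `ρ`. -/
noncomputable def momentTensor {Ω : Type*} [MeasurableSpace Ω] (ν : Measure Ω) (ρ : Ω → ℝ)
    (Y : Ω → E4) (N : ℕ) (I : Fin N → Fin 4) : ℝ := ∫ y, ρ y * ∏ k, Y y (I k) ∂ν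

theorem inner_pow_eq_sum (a b : E4) (N : ℕ) :
    inner ℝ a b ^ N = ∑ I : Fin N → Fin 4, (∏ k, a (I k)) * ∏ k, b (I k) := by
  have h : inner ℝ a b = ∑ i, a i * b i := by
    simp [PiLp.inner_apply, mul_comm]
  rw [h, Fintype.sum_pow]
  simp only [Finset.prod_mul_distrib]

theorem abs_prod_le_norm_pow (a : E4) {N : ℕ} (I : Fin N → Fin 4) : |∏ k, a (I k)| ≤ ‖a‖ ^ N := by
  rw [Finset.abs_prod]
  refine (Finset.prod_le_prod (fun k _ => abs_nonneg _) fun k _ =>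
    PiLp.norm_apply_le a (I k)).trans ?_
  simp

theorem sum_momentTensor_mul {Ω : Type*} [MeasurableSpace Ω] {ν : Measure Ω} {ρ : Ω → ℝ}
    {Y : Ω → E4} {N : ℕ} (hi : ∀ I : Fin N → Fin 4, Integrable (fun y => ρ y * ∏ k, Y y (I k)) ν)
    (a : E4) : ∑ I : Fin N → Fin 4, (∏ k, a (I k)) * momentTensor ν ρ Y N I =
      ∫ y, ρ y * inner ℝ a (Y y) ^ N ∂ν := by
  simp only [momentTensor, ← integral_const_mul]
  rw [← integral_finsetSum _ fun I _ => (hi I).const_mul _]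
  congr 1
  funext y
  rw [inner_pow_eq_sum, Finset.mul_sum]
  exact Finset.sum_congr rfl fun I _ => by ring

theorem sum_momentTensor_mul_momentTensor {Ω : Type*} [MeasurableSpace Ω] {ν : Measure Ω}
    {ρ : Ω → ℝ} {Y : Ω → E4} {N : ℕ}
    (hi : ∀ I : Fin N → Fin 4, Integrable (fun y => ρ y * ∏ k, Y y (I k)) ν)
    (T : (Fin N → Fin 4) → ℝ) : ∑ I, T I * momentTensor ν ρ Y N I =
      ∫ y, ρ y * ∑ I, (∏ k, Y y (I k)) * T I ∂ν := by
  simp only [momentTensor, ← integral_const_mul]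
  rw [← integral_finsetSum _ fun I _ => (hi I).const_mul _]
  congr 1
  funext y
  rw [Finset.mul_sum]
  exact Finset.sum_congr rfl fun I _ => by ring

/-- If the moments of `⟨a, X⟩` are those of the uniform sphere for every `a` among the values of
`X`, they are so for every unit vector `a`. The tensor `T` of the moments of `X` and the tensor
`S` of the Gaussian moments satisfy `|T - S / radialMoment N|² = 0`: expanding the square, each of
the three products is an integral of moments known by hypothesis or by rotation invariance. -/
theorem integral_inner_pow_eq_diskMoment {Ω : Type*} [MeasurableSpace Ω] {μ : Measure Ω}
    [IsProbabilityMeasure μ] {X : Ω → E4} (hX : Measurable X) (hX1 : ∀ y, ‖X y‖ = 1)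
    (hm : ∀ x N, ∫ y, inner ℝ (X x) (X y) ^ N ∂μ = diskMoment N) {a : E4} (ha : ‖a‖ = 1) (N : ℕ) :
    ∫ y, inner ℝ a (X y) ^ N ∂μ = diskMoment N := by
  set m := diskMoment N
  have hA := radialMoment_pos N
  have hiT : ∀ I : Fin N → Fin 4, Integrable (fun y => (1 : ℝ) * ∏ k, X y (I k)) μ := by
    intro I
    refine Integrable.of_bound (C := 1) ?_ (Eventually.of_forall fun y => ?_)
    · refine Measurable.aestronglyMeasurable ?_
      refine measurable_const.mul (Finset.measurable_prod _ fun k _ => ?_)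
      exact (EuclideanSpace.proj (𝕜 := ℝ) (I k)).continuous.measurable.comp hX
    · rw [one_mul, Real.norm_eq_abs]
      exact (abs_prod_le_norm_pow _ I).trans_eq (by rw [hX1, one_pow])
  have hiS : ∀ I : Fin N → Fin 4, Integrable (fun g : E4 => gaussWeight g * ∏ k, g (I k)) := by
    intro I
    refine (integrable_gaussWeight_mul_norm_pow N).mono' ?_ (Eventually.of_forall fun g => ?_)
    · refine Continuous.aestronglyMeasurable (continuous_gaussWeight.mul ?_)
      exact continuous_finsetProd _ fun k _ => (EuclideanSpace.proj (𝕜 := ℝ) (I k)).continuous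
    · rw [norm_mul, Real.norm_of_nonneg (r := gaussWeight g) (Real.exp_pos _).le]
      exact mul_le_mul_of_nonneg_left (abs_prod_le_norm_pow g I) (Real.exp_pos _).le
  set T := momentTensor μ (fun _ => 1) X N with hT
  set S := momentTensor (volume : Measure E4) gaussWeight (fun g => g) N with hS
  have hTX : ∀ b : E4, ∑ I, (∏ k, b (I k)) * T I = ∫ y, inner ℝ b (X y) ^ N ∂μ := by
    intro b
    rw [hT, sum_momentTensor_mul hiT]
    simp
  have hSX : ∀ b : E4, ∑ I, (∏ k, b (I k)) * S I = ‖b‖ ^ N * (m * radialMoment N) := by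
    intro b
    rw [hS, sum_momentTensor_mul hiS, integral_inner_pow]
    congr 1
    simp only [m]
    rw [diskMoment_eq_gauss, div_mul_cancel₀ _ hA.ne']
  have hTT : ∑ I, T I * T I = m := by
    rw [hT, sum_momentTensor_mul_momentTensor hiT]
    simp only [← hT, hTX, hm, m]
    simp
  have hST : ∑ I, S I * T I = m * radialMoment N := by
    rw [hT, sum_momentTensor_mul_momentTensor hiT]
    simp only [hSX, hX1]
    simp
  have hSS : ∑ I, S I * S I = m * radialMoment N * radialMoment N := by
    rw [hS, sum_momentTensor_mul_momentTensor hiS, ← hS]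
    simp only [hSX]
    have e : m * radialMoment N * radialMoment N =
        ∫ g : E4, m * radialMoment N * (gaussWeight g * ‖g‖ ^ N) := (integral_const_mul _ _).symm
    rw [e]
    refine integral_congr_ae (Eventually.of_forall fun g => ?_)
    ring
  have hD : ∑ I, (T I - S I / radialMoment N) ^ 2 = 0 := by
    have : ∀ I, (T I - S I / radialMoment N) ^ 2 = T I * T I - (2 / radialMoment N) * (S I * T I) +
        (1 / (radialMoment N) ^ 2) * (S I * S I) := fun I => by
      field_simp
      ring
    simp only [this, Finset.sum_add_distrib, Finset.sum_sub_distrib, ← Finset.mul_sum]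
    rw [hTT, hST, hSS]
    field_simp
    ring
  have hTS : ∀ I, T I = S I / radialMoment N := fun I => by
    have := (Finset.sum_eq_zero_iff_of_nonneg fun I _ => sq_nonneg _).1 hD I (Finset.mem_univ I)
    exact sub_eq_zero.1 (pow_eq_zero_iff two_ne_zero |>.1 this)
  rw [← hTX]
  simp only [hTS, mul_div_assoc']
  rw [← Finset.sum_div, hSX, ha, one_pow, one_mul, mul_div_cancel_right₀ _ hA.ne']

/-- The moments of `⟨a, X⟩ + 1` do not depend on the unit vector `a`, while their growth detects the
essential supremum; at `a = X x₀` the latter is `2`. -/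
theorem exists_inner_gt {Ω : Type*} [MeasurableSpace Ω] {μ : Measure Ω}
    [IsProbabilityMeasure μ] {X : Ω → E4} (hX : Measurable X) (hX1 : ∀ y, ‖X y‖ = 1)
    (hm : ∀ x N, ∫ y, inner ℝ (X x) (X y) ^ N ∂μ = diskMoment N) {x₀ : Ω}
    (hpos : ∀ ε : ℝ, 0 < ε → 0 < μ {y | 1 - ε < inner ℝ (X x₀) (X y)})
    {a : E4} (ha : ‖a‖ = 1) {ε : ℝ} (hε : 0 < ε) : ∃ y, 1 - ε < inner ℝ a (X y) := by
  by_contra! hcon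
  have hmeas : ∀ b : E4, Measurable fun y => inner ℝ b (X y) := fun b =>
    (innerSL ℝ b).continuous.measurable.comp hX
  have hbd : ∀ b : E4, ‖b‖ = 1 → ∀ y, |inner ℝ b (X y)| ≤ 1 := fun b hb y => by
    have := abs_real_inner_le_norm b (X y)
    rwa [hb, hX1, one_mul] at this
  have hint : ∀ (b : E4), ‖b‖ = 1 → ∀ N : ℕ, Integrable (fun y => inner ℝ b (X y) ^ N) μ := by
    intro b hb N
    refine Integrable.of_bound (C := 1) ((hmeas b).pow_const N).aestronglyMeasurable
      (Eventually.of_forall fun y => ?_)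
    rw [norm_pow]
    exact pow_le_one₀ (norm_nonneg _) (hbd b hb y)
  have hexp : ∀ b : E4, ‖b‖ = 1 → (∀ N, ∫ y, inner ℝ b (X y) ^ N ∂μ = diskMoment N) → ∀ N : ℕ,
      ∫ y, (inner ℝ b (X y) + 1) ^ N ∂μ =
        ∑ j ∈ Finset.range (N + 1), diskMoment j * (N.choose j : ℝ) := by
    intro b hb hb2 N
    simp only [add_pow, one_pow, mul_one]
    rw [integral_finsetSum _ fun j _ => (hint b hb j).mul_const _]
    simp only [integral_mul_const, hb2]
  have heq : ∀ N : ℕ, ∫ y, (inner ℝ a (X y) + 1) ^ N ∂μ =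
      ∫ y, (inner ℝ (X x₀) (X y) + 1) ^ N ∂μ := by
    intro N
    rw [hexp a ha (fun N => integral_inner_pow_eq_diskMoment hX hX1 hm ha N),
      hexp (X x₀) (hX1 x₀) (hm x₀)]
  set A := {y | 1 - ε / 2 < inner ℝ (X x₀) (X y)} with hAdef
  have hAm : MeasurableSet A := measurableSet_lt measurable_const (hmeas _)
  have hApos : 0 < μ.real A := ENNReal.toReal_pos (hpos _ (half_pos hε)).ne' (measure_ne_top _ _)
  obtain ⟨y₀⟩ : Nonempty Ω := ⟨x₀⟩
  have hε2 : ε ≤ 2 := by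
    have h1 := hcon y₀
    have h2 := (abs_le.1 (hbd a ha y₀)).1
    linarith
  have hint1 : ∀ (b : E4), ‖b‖ = 1 → ∀ N : ℕ,
      Integrable (fun y => (inner ℝ b (X y) + 1) ^ N) μ := by
    intro b hb N
    simp only [add_pow, one_pow, mul_one]
    exact integrable_finsetSum _ fun j _ => (hint b hb j).mul_const _
  have hupper : ∀ N : ℕ, ∫ y, (inner ℝ a (X y) + 1) ^ N ∂μ ≤ (2 - ε) ^ N := by
    intro N
    have h := integral_mono (hint1 a ha N) (integrable_const ((2 - ε) ^ N)) fun y => by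
      have h1 := (abs_le.1 (hbd a ha y)).1
      exact pow_le_pow_left₀ (by linarith) (by linarith [hcon y]) N
    simpa using h
  have hlower : ∀ N : ℕ, (2 - ε / 2) ^ N * μ.real A ≤ ∫ y, (inner ℝ (X x₀) (X y) + 1) ^ N ∂μ := by
    intro N
    have hnn : ∀ y, 0 ≤ (inner ℝ (X x₀) (X y) + 1) ^ N := fun y =>
      pow_nonneg (by linarith [(abs_le.1 (hbd _ (hX1 x₀) y)).1]) N
    calc (2 - ε / 2) ^ N * μ.real A = ∫ y in A, (2 - ε / 2) ^ N ∂μ := by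
          rw [setIntegral_const, smul_eq_mul, mul_comm]
      _ ≤ ∫ y in A, (inner ℝ (X x₀) (X y) + 1) ^ N ∂μ := by
          refine setIntegral_mono_on (integrable_const _).integrableOn
            (hint1 _ (hX1 x₀) N).integrableOn hAm fun y hy => ?_
          have hy' : 1 - ε / 2 < inner ℝ (X x₀) (X y) := hy
          exact pow_le_pow_left₀ (by linarith) (by linarith) N
      _ ≤ _ := setIntegral_le_integral (hint1 _ (hX1 x₀) N) (Eventually.of_forall hnn)
  have hq0 : 0 ≤ (2 - ε) / (2 - ε / 2) := div_nonneg (by linarith) (by linarith)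
  have hq1 : (2 - ε) / (2 - ε / 2) < 1 := by
    rw [div_lt_one (by linarith)]; linarith
  have hle : ∀ N : ℕ, μ.real A ≤ ((2 - ε) / (2 - ε / 2)) ^ N := by
    intro N
    rw [div_pow, le_div_iff₀ (pow_pos (by linarith) N), mul_comm]
    exact (hlower N).trans ((heq N).symm.le.trans (hupper N))
  exact absurd (ge_of_tendsto' (tendsto_pow_atTop_nhds_zero_of_lt_one hq0 hq1) hle) (not_le.2 hApos)

/-! ### Dual bases in inner product spaces -/

section

section InnerProductSpace

variable {E : Type*} [NormedAddCommGroup E] [InnerProductSpace ℝ E]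

theorem real_inner_smul_smul (a b : ℝ) (v w : E) :
    inner ℝ (a • v) (b • w) = a * b * inner ℝ v w := by
  rw [real_inner_smul_left, real_inner_smul_right]
  ring

theorem norm_sum_smul_sq {ι : Type*} [Fintype ι] (v : ι → E) (ζ : ι → ℝ) :
    ‖∑ i, ζ i • v i‖ ^ 2 = ∑ i, ∑ j, inner ℝ (v i) (v j) * ζ i * ζ j := by
  rw [← real_inner_self_eq_norm_sq, sum_inner]
  refine Finset.sum_congr rfl fun i _ => ?_
  rw [inner_sum]
  refine Finset.sum_congr rfl fun j _ => ?_
  rw [real_inner_smul_smul]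
  ring

theorem sum_inner_smul_of_dual {ι : Type*} [Fintype ι] [DecidableEq ι] (b : Module.Basis ι ℝ E)
    {v : ι → E} (h : ∀ i j, inner ℝ (v j) (b i) = if i = j then 1 else 0) (g : E) :
    ∑ j, inner ℝ g (b j) • v j = g := by
  have h0 : ∀ i, inner ℝ (∑ j, inner ℝ g (b j) • v j - g) (b i) = 0 := by
    intro i
    rw [inner_sub_left, sum_inner]
    simp [real_inner_smul_left, h]
  refine sub_eq_zero.1 (inner_self_eq_zero (𝕜 := ℝ).1 ?_)
  set d := ∑ j, inner ℝ g (b j) • v j - g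
  nth_rewrite 2 [← b.sum_repr d]
  rw [inner_sum]
  exact Finset.sum_eq_zero fun i _ => by rw [real_inner_smul_right, h0, mul_zero]

theorem inner_sum_smul_of_dual {ι : Type*} [Fintype ι] [DecidableEq ι] {b v : ι → E}
    (h : ∀ i j, inner ℝ (v j) (b i) = if i = j then 1 else 0) (ζ : ι → ℝ) (i : ι) :
    inner ℝ (∑ j, ζ j • v j) (b i) = ζ i := by
  rw [sum_inner]
  simp [real_inner_smul_left, h]

theorem linearIndependent_of_dual {ι : Type*} [Fintype ι] [DecidableEq ι] {b v : ι → E}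
    (h : ∀ i j, inner ℝ (v j) (b i) = if i = j then 1 else 0) : LinearIndependent ℝ v := by
  refine Fintype.linearIndependent_iff.2 fun ζ hζ i => ?_
  rw [← inner_sum_smul_of_dual h ζ i, hζ, inner_zero_left]

/-- A family that spans contains a basis, and the inner product turns the dual basis into one of
vectors. -/
theorem exists_dual_basis_of_span_eq_top {M : Type*} {w : M → E} {n : ℕ} [FiniteDimensional ℝ E]
    (hn : Module.finrank ℝ E = n) (hw : Submodule.span ℝ (Set.range w) = ⊤) :
    ∃ (x : Fin n → M) (b : Module.Basis (Fin n) ℝ E),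
      ∀ i j, inner ℝ (w (x j)) (b i) = if i = j then 1 else 0 := by
  obtain ⟨v, hv, hspan, -⟩ := Submodule.exists_fun_fin_finrank_span_eq ℝ (Set.range w)
  have hd : Module.finrank ℝ (Submodule.span ℝ (Set.range w)) = n := by
    rw [hw, finrank_top, hn]
  choose x hx using hv
  let A : E →ₗ[ℝ] (Fin n → ℝ) := LinearMap.pi fun j => innerₛₗ ℝ (w (x (Fin.cast hd.symm j)))
  have hA : Function.Injective A := by
    refine (injective_iff_map_eq_zero A).2 fun f hf => ?_
    have h1 : f ∈ (Submodule.span ℝ (Set.range v))ᗮ := by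
      rw [Submodule.mem_orthogonal]
      intro u hu
      induction hu using Submodule.span_induction with
      | mem u hu =>
        obtain ⟨i, rfl⟩ := hu
        have := congrFun hf (Fin.cast hd i)
        simpa [A, hx] using this
      | zero => simp
      | add u u' _ _ h h' => rw [inner_add_left, h, h', add_zero]
      | smul a u _ h => rw [real_inner_smul_left, h, mul_zero]
    rw [hspan, hw, Submodule.top_orthogonal_eq_bot] at h1
    exact (Submodule.mem_bot ℝ).1 h1
  let e := LinearMap.linearEquivOfInjective A hA (by rw [hn]; simp)
  refine ⟨fun j => x (Fin.cast hd.symm j), (Pi.basisFun ℝ (Fin n)).map e.symm, fun i j => ?_⟩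
  have h1 : e (((Pi.basisFun ℝ (Fin n)).map e.symm) i) j =
      inner ℝ (w (x (Fin.cast hd.symm j))) (((Pi.basisFun ℝ (Fin n)).map e.symm) i) := rfl
  rw [← h1]
  simp [Pi.single_apply, eq_comm]

end InnerProductSpace

variable {M : Type*} [TopologicalSpace M] [MeasurableSpace M] {r θ : M → M → ℝ} {μ : Measure M}

/-! ### Separation of points -/

namespace IsHopfHeatSpace

/-- If `cos r cos θ` is near `1`, then `r` and `θ` are both small, uniformly on `M × M`. -/
theorem exists_forall_lt_of_cos_mul_cos (hM : IsHopfHeatSpace r θ μ) {ε : ℝ} (hε : 0 < ε) :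
    ∃ η > 0, ∀ x y, 1 - η < Real.cos (r x y) * Real.cos (θ x y) → r x y < ε ∧ θ x y < ε := by
  set ε' := min ε 1 with hε'
  have hε0 : 0 < ε' := lt_min hε one_pos
  have hpi : ε' ≤ Real.pi := (min_le_right _ _).trans (by linarith [Real.pi_gt_three])
  have hcos : Real.cos ε' < 1 := by
    rw [← Real.cos_zero]
    exact Real.cos_lt_cos_of_nonneg_of_le_pi le_rfl hpi hε0
  have hcos0 : 0 < Real.cos ε' := Real.cos_pos_of_mem_Ioo
    ⟨by linarith [Real.pi_pos], by linarith [min_le_right ε 1, Real.pi_gt_three]⟩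
  refine ⟨1 - Real.cos ε', by linarith, fun x y h => ?_⟩
  have key : ∀ s : ℝ, 0 ≤ s → s ≤ Real.pi → Real.cos ε' < Real.cos s → s < ε := by
    intro s hs0 hs1 hs
    by_contra! hcon
    exact absurd (Real.cos_le_cos_of_nonneg_of_le_pi hε0.le hs1 ((min_le_left _ _).trans hcon))
      (not_le.2 hs)
  have hmul := h
  rw [sub_sub_cancel] at hmul
  have hd0 : 0 ≤ Real.cos (θ x y) := by
    by_contra! hd'
    nlinarith [mul_nonpos_of_nonneg_of_nonpos (hM.cos_nonneg x y) hd'.le]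
  exact ⟨key _ (hM.r_nonneg x y) ((hM.r_le x y).trans (by linarith [Real.pi_pos]))
      (hmul.trans_le (mul_le_of_le_one_right (hM.cos_nonneg x y) (Real.cos_le_one _))),
    key _ (hM.θ_nonneg x y) (hM.θ_le x y)
      (hmul.trans_le (mul_le_of_le_one_left hd0 (Real.cos_le_one _)))⟩

theorem eq_of_cos_mul_cos_eq_one (hM : IsHopfHeatSpace r θ μ) {x y : M}
    (h : Real.cos (r x y) * Real.cos (θ x y) = 1) : x = y := by
  have hsmall : ∀ ε : ℝ, 0 < ε → r x y < ε ∧ θ x y < ε := fun ε hε => by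
    obtain ⟨η, hη, h'⟩ := hM.exists_forall_lt_of_cos_mul_cos hε
    exact h' x y (by linarith)
  exact hM.separated x y
    (le_antisymm (le_of_forall_pos_lt_add fun ε hε => by simpa using (hsmall ε hε).1)
      (hM.r_nonneg x y))
    (le_antisymm (le_of_forall_pos_lt_add fun ε hε => by simpa using (hsmall ε hε).2)
      (hM.θ_nonneg x y))

/-! ### The dimension of the eigenspace and the evaluation map -/

variable [BorelSpace M]

theorem integral_inner_evalVec_sq [IsProbabilityMeasure μ] [μ.IsOpenPosMeasure]
    (hM : IsHopfHeatSpace r θ μ) {f : Lp ℝ 2 μ} (hf : f ∈ E01 r θ μ) :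
    ∫ x, inner ℝ (hM.evalVec x) f ^ 2 ∂μ = ‖f‖ ^ 2 := by
  rw [← real_inner_self_eq_norm_sq, L2.inner_def]
  refine integral_congr_ae ?_
  filter_upwards [hM.coeFn_eq_inner_evalVec hf] with x hx
  simp [hx, sq]

theorem integrable_inner_evalVec_sq [IsProbabilityMeasure μ] [μ.IsOpenPosMeasure]
    (hM : IsHopfHeatSpace r θ μ) {f : Lp ℝ 2 μ} (hf : f ∈ E01 r θ μ) :
    Integrable (fun x => inner ℝ (hM.evalVec x) f ^ 2) μ := by
  refine (Lp.memLp f).integrable_sq.congr ?_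
  filter_upwards [hM.coeFn_eq_inner_evalVec hf] with x hx
  rw [hx]

theorem norm_sq_evalVec [IsFiniteMeasure μ] [μ.IsOpenPosMeasure]
    (hM : IsHopfHeatSpace r θ μ) (x : M) : ‖hM.evalVec x‖ ^ 2 = 4 := by
  rw [← real_inner_self_eq_norm_sq, inner_evalVec_evalVec, hM.r_self, hM.θ_self]
  simp

/-- Integration of the squares of an orthonormal family of eigenfunctions, in their continuous
versions. -/
theorem card_eq_integral [IsProbabilityMeasure μ] [μ.IsOpenPosMeasure]
    (hM : IsHopfHeatSpace r θ μ) {ι : Type*} [Fintype ι] {e : ι → Lp ℝ 2 μ} (he : Orthonormal ℝ e)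
    (hmem : ∀ i, e i ∈ E01 r θ μ) :
    (Fintype.card ι : ℝ) = ∫ x, ∑ i, inner ℝ (hM.evalVec x) (e i) ^ 2 ∂μ := by
  rw [integral_finsetSum _ fun i _ => hM.integrable_inner_evalVec_sq (hmem i)]
  simp [hM.integral_inner_evalVec_sq (hmem _), he.1]

/-- Bessel's inequality for `evalVec x`, integrated over `x`. -/
theorem card_le_four [IsProbabilityMeasure μ] [μ.IsOpenPosMeasure]
    (hM : IsHopfHeatSpace r θ μ) {ι : Type*} [Fintype ι] {e : ι → Lp ℝ 2 μ} (he : Orthonormal ℝ e)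
    (hmem : ∀ i, e i ∈ E01 r θ μ) : Fintype.card ι ≤ 4 := by
  have h : (Fintype.card ι : ℝ) ≤ 4 := by
    rw [hM.card_eq_integral he hmem]
    have h4 : ∫ _ : M, (4 : ℝ) ∂μ = 4 := by simp
    rw [← h4]
    refine integral_mono (integrable_finsetSum _ fun i _ => hM.integrable_inner_evalVec_sq (hmem i))
      (integrable_const _) fun x => ?_
    have hb := he.sum_inner_products_le (x := hM.evalVec x) (s := Finset.univ)
    rw [hM.norm_sq_evalVec] at hb
    refine le_trans (le_of_eq (Finset.sum_congr rfl fun i _ => ?_)) hb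
    rw [Real.norm_eq_abs, sq_abs, real_inner_comm]
  exact_mod_cast h

theorem rank_E01_le [IsProbabilityMeasure μ] [μ.IsOpenPosMeasure]
    (hM : IsHopfHeatSpace r θ μ) : Module.rank ℝ (E01 r θ μ) ≤ (4 : ℕ) := by
  refine rank_le fun s hs => ?_
  set F := Submodule.span ℝ (s : Set (E01 r θ μ))
  have hcard : Module.finrank ℝ F = s.card := finrank_span_finset_eq_card hs
  have hfin : FiniteDimensional ℝ F := FiniteDimensional.span_finset ℝ s
  have ho : Orthonormal ℝ fun i =>
      (E01 r θ μ).subtypeₗᵢ (F.subtypeₗᵢ (stdOrthonormalBasis ℝ F i)) :=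
    ((stdOrthonormalBasis ℝ F).orthonormal.comp_linearIsometry F.subtypeₗᵢ).comp_linearIsometry
      (E01 r θ μ).subtypeₗᵢ
  have := hM.card_le_four ho fun i => (F.subtypeₗᵢ (stdOrthonormalBasis ℝ F i)).2
  rwa [Fintype.card_fin, hcard] at this

theorem finiteDimensional_E01 [IsProbabilityMeasure μ] [μ.IsOpenPosMeasure]
    (hM : IsHopfHeatSpace r θ μ) : FiniteDimensional ℝ (E01 r θ μ) :=
  Module.rank_lt_aleph0_iff.1 (hM.rank_E01_le.trans_lt Cardinal.natCast_lt_aleph0)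

/-- The evaluation vector `evalVec x` as an element of `E_{0,1}`. -/
noncomputable def evalE01 [IsFiniteMeasure μ] [μ.IsOpenPosMeasure] (hM : IsHopfHeatSpace r θ μ)
    (x : M) : E01 r θ μ := ⟨hM.evalVec x, hM.evalVec_mem x⟩

theorem inner_evalE01 [IsFiniteMeasure μ] [μ.IsOpenPosMeasure] (hM : IsHopfHeatSpace r θ μ)
    (x y : M) : inner ℝ (hM.evalE01 x) (hM.evalE01 y) = 4 * (Real.cos (r x y) * Real.cos (θ x y)) :=
  hM.inner_evalVec_evalVec x y

theorem norm_evalE01 [IsFiniteMeasure μ] [μ.IsOpenPosMeasure] (hM : IsHopfHeatSpace r θ μ)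
    (x : M) : ‖hM.evalE01 x‖ = 2 := by
  have h := hM.norm_sq_evalVec x
  have h2 : ‖hM.evalE01 x‖ = ‖hM.evalVec x‖ := rfl
  rw [h2]
  nlinarith [norm_nonneg (hM.evalVec x)]

theorem evalE01_injective [IsFiniteMeasure μ] [μ.IsOpenPosMeasure] (hM : IsHopfHeatSpace r θ μ) :
    Function.Injective hM.evalE01 := by
  intro x y h
  refine hM.eq_of_cos_mul_cos_eq_one ?_
  have h1 := hM.inner_evalE01 x y
  rw [h, real_inner_self_eq_norm_sq, hM.norm_evalE01] at h1
  linarith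

theorem continuous_inner_evalE01 [IsFiniteMeasure μ] [μ.IsOpenPosMeasure]
    (hM : IsHopfHeatSpace r θ μ) (f : E01 r θ μ) : Continuous fun x => inner ℝ (hM.evalE01 x) f :=
  hM.continuous_inner_evalVec (f : Lp ℝ 2 μ)

theorem coeFn_eq_inner_evalE01 [IsProbabilityMeasure μ] [μ.IsOpenPosMeasure]
    (hM : IsHopfHeatSpace r θ μ) (f : E01 r θ μ) :
    ((f : Lp ℝ 2 μ) : M → ℝ) =ᵐ[μ] fun x => inner ℝ (hM.evalE01 x) f :=
  hM.coeFn_eq_inner_evalVec f.2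

theorem eq_zero_of_inner_evalE01 [IsProbabilityMeasure μ] [μ.IsOpenPosMeasure]
    (hM : IsHopfHeatSpace r θ μ) {f : E01 r θ μ} (h : ∀ x, inner ℝ (hM.evalE01 x) f = 0) :
    f = 0 := by
  have h1 := hM.coeFn_eq_inner_evalE01 f
  simp only [h] at h1
  exact Subtype.ext ((Lp.eq_zero_iff_ae_eq_zero).2 h1)

/-- Parseval's identity for `evalE01 x`, integrated over `x`. -/
theorem finrank_E01 [IsProbabilityMeasure μ] [μ.IsOpenPosMeasure]
    (hM : IsHopfHeatSpace r θ μ) : Module.finrank ℝ (E01 r θ μ) = 4 := by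
  have := hM.finiteDimensional_E01
  set b := stdOrthonormalBasis ℝ (E01 r θ μ)
  have h := hM.card_eq_integral (b.orthonormal.comp_linearIsometry (E01 r θ μ).subtypeₗᵢ)
    fun i => (b i).2
  have h2 : ∀ x, ∑ i, inner ℝ (hM.evalVec x) (((E01 r θ μ).subtypeₗᵢ ∘ b) i) ^ 2 = 4 := by
    intro x
    have := b.sum_sq_norm_inner_left (hM.evalE01 x)
    rw [hM.norm_evalE01] at this
    norm_num at this
    exact this
  simp only [h2, Fintype.card_fin] at h
  simp at h
  exact_mod_cast h

theorem span_range_evalE01 [IsProbabilityMeasure μ] [μ.IsOpenPosMeasure]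
    (hM : IsHopfHeatSpace r θ μ) : Submodule.span ℝ (Set.range hM.evalE01) = ⊤ := by
  have := hM.finiteDimensional_E01
  rw [← Submodule.orthogonal_eq_bot_iff, Submodule.eq_bot_iff]
  intro f hf
  refine hM.eq_zero_of_inner_evalE01 fun x => ?_
  exact (Submodule.mem_orthogonal _ _).1 hf _ (Submodule.subset_span ⟨x, rfl⟩)

theorem exists_isDualEigenbasis [IsProbabilityMeasure μ] [μ.IsOpenPosMeasure]
    (hM : IsHopfHeatSpace r θ μ) : ∃ (x : Fin 4 → M) (φ : Fin 4 → M → ℝ),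
      IsDualEigenbasis r θ μ x φ := by
  have hfin := hM.finiteDimensional_E01
  obtain ⟨x, b, hb⟩ := exists_dual_basis_of_span_eq_top hM.finrank_E01 hM.span_range_evalE01
  exact ⟨x, fun i z => inner ℝ (hM.evalE01 z) (b i), fun i => hM.continuous_inner_evalE01 (b i),
    ⟨b, fun i => hM.coeFn_eq_inner_evalE01 (b i)⟩, hb⟩

theorem delta_eq_angle [IsFiniteMeasure μ] [μ.IsOpenPosMeasure] (hM : IsHopfHeatSpace r θ μ)
    (x y : M) : delta r θ x y = InnerProductGeometry.angle (hM.evalE01 x) (hM.evalE01 y) := by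
  rw [InnerProductGeometry.angle, hM.inner_evalE01, hM.norm_evalE01, hM.norm_evalE01, delta]
  congr 1
  ring

theorem isMetric_delta [IsFiniteMeasure μ] [μ.IsOpenPosMeasure] (hM : IsHopfHeatSpace r θ μ) :
    IsMetric (delta r θ) where
  nonneg x y := Real.arccos_nonneg _
  eq_zero_iff x y := by
    rw [delta, Real.arccos_eq_zero]
    constructor
    · intro h
      refine hM.eq_of_cos_mul_cos_eq_one (le_antisymm ?_ h)
      refine (le_abs_self _).trans ?_
      rw [abs_mul]
      exact mul_le_one₀ (Real.abs_cos_le_one _) (abs_nonneg _) (Real.abs_cos_le_one _)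
    · rintro rfl
      simp [hM.r_self, hM.θ_self]
  symm x y := by rw [delta, delta, hM.r_symm, hM.θ_symm]
  triangle x y z := by
    simp only [hM.delta_eq_angle]
    exact InnerProductGeometry.angle_le_angle_add_angle _ _ _

/-- The evaluation vectors fill the sphere of radius two: their closure does, by the comparison of
moments, and by completeness their set is closed. -/
theorem exists_evalE01_eq [IsProbabilityMeasure μ] [μ.IsOpenPosMeasure] [Nonempty M]
    (hM : IsHopfHeatSpace r θ μ) {g : E01 r θ μ} (hg : ‖g‖ = 2) : ∃ z, hM.evalE01 z = g := by
  have hfin := hM.finiteDimensional_E01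
  -- the images `½ f_1(x, ·)` are moved to the unit sphere of the standard Euclidean space
  set R : E01 r θ μ ≃ₗᵢ[ℝ] E4 :=
    ((stdOrthonormalBasis ℝ (E01 r θ μ)).reindex (finCongr hM.finrank_E01)).repr with hR
  set X : M → E4 := fun x => R ((1 / 2 : ℝ) • hM.evalE01 x) with hX
  have hXinner : ∀ x y, inner ℝ (X x) (X y) = Real.cos (r x y) * Real.cos (θ x y) := by
    intro x y
    rw [hX, LinearIsometryEquiv.inner_map_map]
    refine (real_inner_smul_smul (1 / 2) (1 / 2) (hM.evalE01 x) (hM.evalE01 y)).trans ?_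
    rw [hM.inner_evalE01]
    ring
  have hX1 : ∀ x, ‖X x‖ = 1 := by
    intro x
    rw [hX, LinearIsometryEquiv.norm_map, norm_smul, hM.norm_evalE01]
    norm_num
  set a : E4 := R ((1 / 2 : ℝ) • g) with ha
  have ha1 : ‖a‖ = 1 := by
    rw [ha, LinearIsometryEquiv.norm_map, norm_smul, hg]
    norm_num
  have hXm : Measurable X := by
    set bb := (stdOrthonormalBasis ℝ (E01 r θ μ)).reindex (finCongr hM.finrank_E01) with hbb
    have hc : Continuous fun x =>
        (WithLp.toLp 2 fun i : Fin 4 => inner ℝ (hM.evalE01 x) ((1 / 2 : ℝ) • bb i) : E4) :=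
      (PiLp.continuous_toLp 2 (fun _ : Fin 4 => ℝ)).comp
        (continuous_pi fun i => hM.continuous_inner_evalE01 _)
    refine (hc.congr fun x => ?_).measurable
    ext i
    refine (real_inner_smul_right (hM.evalE01 x) (bb i) (1 / 2)).trans ?_
    refine Eq.trans ?_ (bb.repr_apply_apply ((1 / 2 : ℝ) • hM.evalE01 x) i).symm
    refine Eq.trans ?_ (real_inner_smul_right (bb i) (hM.evalE01 x) (1 / 2)).symm
    rw [real_inner_comm]
  have hm : ∀ x N, ∫ y, inner ℝ (X x) (X y) ^ N ∂μ = diskMoment N := by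
    intro x N
    simp only [hXinner]
    refine integral_pow_eq_diskMoment (fun y => (Real.cos (r x y), θ x y))
      (fun L => hM.integrable_layerKernel L x)
      (fun L L' => hM.integrable_layerKernel_mul L x (hM.integrable_layerKernel L' x))
      (fun L => hM.integral_layerKernel L x) (fun L L' => ?_) N
    refine (hM.integral_layerKernel_mul_layerKernel L L' x x).trans ?_
    rw [hM.layerKernel_self]
    simp only [eq_comm]
  obtain ⟨x₀⟩ := ‹Nonempty M›
  have hcontX : ∀ x, Continuous fun y => inner ℝ (X x) (X y) := by
    intro x
    simp only [hXinner]
    have := (hM.continuous_layerKernel_right 1 x).const_mul (1 / 4 : ℝ)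
    refine this.congr fun y => ?_
    rw [layerKernel, layer_one]
    ring
  have hpos : ∀ ε : ℝ, 0 < ε → 0 < μ {y | 1 - ε < inner ℝ (X x₀) (X y)} := by
    intro ε hε
    refine (isOpen_lt continuous_const (hcontX x₀)).measure_pos μ ⟨x₀, ?_⟩
    simp only [Set.mem_ofPred_eq, hXinner, hM.r_self, hM.θ_self, Real.cos_zero]
    linarith
  have hex : ∀ n : ℕ, ∃ y, 1 - 1 / ((n : ℝ) + 1) < inner ℝ a (X y) := fun n =>
    exists_inner_gt hXm hX1 hm hpos ha1 (by positivity)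
  choose u hu using hex
  have hdist : ∀ b c : E4, ‖b‖ = 1 → ‖c‖ = 1 → ‖b - c‖ ^ 2 = 2 - 2 * inner ℝ b c := by
    intro b c hb hc
    rw [norm_sub_sq_real, hb, hc]
    ring
  have hlim : Tendsto (fun n => X (u n)) atTop (𝓝 a) := by
    rw [tendsto_iff_norm_sub_tendsto_zero]
    have h2 : Tendsto (fun n : ℕ => 2 * (1 / ((n : ℝ) + 1))) atTop (𝓝 (2 * 0)) :=
      tendsto_one_div_add_atTop_nhds_zero_nat.const_mul 2
    rw [mul_zero] at h2
    have h3 : Tendsto (fun n => ‖X (u n) - a‖ ^ 2) atTop (𝓝 0) := by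
      refine squeeze_zero (fun n => sq_nonneg _) (fun n => ?_) h2
      rw [hdist _ _ (hX1 _) ha1, real_inner_comm]
      linarith [hu n]
    have h4 := (Real.continuous_sqrt.tendsto 0).comp h3
    simpa [Function.comp_def, Real.sqrt_sq] using h4
  -- the preimages of a convergent sequence of images form a Cauchy sequence for both `r` and `θ`
  have hC : ∀ η : ℝ, 0 < η → ∃ N, ∀ m, N ≤ m → ∀ n, N ≤ n →
      1 - η < Real.cos (r (u m) (u n)) * Real.cos (θ (u m) (u n)) := by
    intro η hη
    obtain ⟨N, hN⟩ := Metric.cauchySeq_iff.1 hlim.cauchySeq (Real.sqrt (2 * η))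
      (Real.sqrt_pos.2 (by linarith))
    refine ⟨N, fun m hm n hn => ?_⟩
    have h1 := hN m hm n hn
    rw [dist_eq_norm] at h1
    have h2 := hdist _ _ (hX1 (u m)) (hX1 (u n))
    rw [Real.lt_sqrt (norm_nonneg _), h2, hXinner] at h1
    linarith
  obtain ⟨x, hx1, hx2⟩ := hM.complete u
    (fun ε hε => by
      obtain ⟨η, hη, h⟩ := hM.exists_forall_lt_of_cos_mul_cos hε
      obtain ⟨N, hN⟩ := hC η hη
      exact ⟨N, fun m hm n hn => (h _ _ (hN m hm n hn)).1⟩)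
    (fun ε hε => by
      obtain ⟨η, hη, h⟩ := hM.exists_forall_lt_of_cos_mul_cos hε
      obtain ⟨N, hN⟩ := hC η hη
      exact ⟨N, fun m hm n hn => (h _ _ (hN m hm n hn)).2⟩)
  have hlim2 : Tendsto (fun n => inner ℝ (X (u n)) (X x)) atTop (𝓝 1) := by
    simp only [hXinner]
    have := ((Real.continuous_cos.tendsto 0).comp hx1).mul
      ((Real.continuous_cos.tendsto 0).comp hx2)
    simpa using this
  have hlim3 : Tendsto (fun n => inner ℝ (X (u n)) (X x)) atTop (𝓝 (inner ℝ a (X x))) :=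
    hlim.inner tendsto_const_nhds
  have h1 := tendsto_nhds_unique hlim3 hlim2
  have h2 := hdist a (X x) ha1 (hX1 x)
  rw [h1] at h2
  norm_num at h2
  refine ⟨x, ?_⟩
  have h3 := R.injective (sub_eq_zero.1 h2)
  exact (smul_right_injective _ (by norm_num : (1 / 2 : ℝ) ≠ 0) h3).symm

end IsHopfHeatSpace

/-! ### The isometry in coordinates -/

/-- The coordinates `ζ` stand for the vector `½ ∑ ζ_i f_1(x_i, ·)` of `E_{0,1}`. -/
theorem quad_gram [BorelSpace M] [IsFiniteMeasure μ] [μ.IsOpenPosMeasure]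
    (hM : IsHopfHeatSpace r θ μ) (x : Fin 4 → M) (ζ : Fin 4 → ℝ) :
    quad (gram r θ x) ζ = ‖∑ i, ζ i • hM.evalE01 (x i)‖ ^ 2 / 4 := by
  have h := norm_sum_smul_sq (fun i => hM.evalE01 (x i)) ζ
  simp only [hM.inner_evalE01] at h
  rw [quad, eq_div_iff four_ne_zero, Finset.sum_mul]
  refine Eq.trans (Finset.sum_congr rfl fun i _ => ?_) h.symm
  rw [Finset.sum_mul]
  refine Finset.sum_congr rfl fun j _ => ?_
  simp only [gram, Matrix.of_apply]
  ring

/-- A chord of length `√(2 - 2 cos δ)` of the unit circle subtends the angle `δ`. -/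
theorem two_mul_arcsin_eq_arccos {u : ℝ} (h0 : -1 ≤ u) (h1 : u ≤ 1) :
    2 * Real.arcsin (Real.sqrt (2 - 2 * u) / 2) = Real.arccos u := by
  set δ := Real.arccos u
  have hδ0 : 0 ≤ δ := Real.arccos_nonneg u
  have hδ1 : δ ≤ Real.pi := Real.arccos_le_pi u
  have hu : Real.cos δ = u := Real.cos_arccos h0 h1
  have hs : 0 ≤ Real.sin (δ / 2) := Real.sin_nonneg_of_nonneg_of_le_pi (by linarith) (by linarith)
  have h2 : 2 - 2 * u = (2 * Real.sin (δ / 2)) ^ 2 := by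
    have h3 := Real.cos_two_mul (δ / 2)
    have h4 := Real.sin_sq_add_cos_sq (δ / 2)
    rw [mul_div_cancel₀ _ two_ne_zero, hu] at h3
    nlinarith
  rw [h2, Real.sqrt_sq (by linarith), mul_div_cancel_left₀ _ two_ne_zero,
    Real.arcsin_sin (by linarith) (by linarith)]
  ring

theorem isometry_of_isDualEigenbasis [BorelSpace M] [Nonempty M] [IsProbabilityMeasure μ]
    [μ.IsOpenPosMeasure] (hM : IsHopfHeatSpace r θ μ) {x : Fin 4 → M} {φ : Fin 4 → M → ℝ}
    (hx : IsDualEigenbasis r θ μ x φ) :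
    (gram r θ x).PosDef ∧
      Set.BijOn (fun y i => φ i y) Set.univ (sphere3 (gram r θ x)) ∧
      ∀ y z : M, sphereDist (gram r θ x) (fun i => φ i y) (fun i => φ i z) = delta r θ y z := by
  obtain ⟨b, hb⟩ := hx.basis
  have hφ : ∀ i z, φ i z = inner ℝ (hM.evalE01 z) (b i) := fun i z =>
    congrFun (Measure.eq_of_ae_eq ((hb i).symm.trans (hM.coeFn_eq_inner_evalE01 (b i)))
      (hx.continuous i) (hM.continuous_inner_evalE01 (b i))) z
  have hdual : ∀ i j, inner ℝ (hM.evalE01 (x j)) (b i) = if i = j then 1 else 0 := fun i j => by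
    rw [← hφ, hx.dual]
  have hsum : ∀ z, ∑ j, φ j z • hM.evalE01 (x j) = hM.evalE01 z := fun z => by
    simp only [hφ]
    exact sum_inner_smul_of_dual b hdual (hM.evalE01 z)
  have hu : ∀ y z, |Real.cos (r y z) * Real.cos (θ y z)| ≤ 1 := fun y z => by
    rw [abs_mul]
    exact mul_le_one₀ (Real.abs_cos_le_one _) (abs_nonneg _) (Real.abs_cos_le_one _)
  refine ⟨?_, ⟨?_, ?_, ?_⟩, ?_⟩
  · have h1 := Matrix.posDef_gram_of_linearIndependent (𝕜 := ℝ) (linearIndependent_of_dual hdual)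
    have h2 : gram r θ x = (1 / 4 : ℝ) • Matrix.gram ℝ fun j => hM.evalE01 (x j) := by
      ext i j
      simp only [gram, Matrix.of_apply, Matrix.smul_apply, Matrix.gram_apply, smul_eq_mul,
        hM.inner_evalE01]
      ring
    rw [h2]
    exact h1.smul (by norm_num)
  · intro z _
    change quad _ _ = 1
    rw [quad_gram hM, hsum, hM.norm_evalE01]
    norm_num
  · intro y _ z _ h
    refine hM.evalE01_injective ?_
    rw [← hsum y, ← hsum z]
    exact Finset.sum_congr rfl fun j _ => by
      rw [show φ j y = φ j z from congrFun h j]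
  · intro ζ hζ
    have hζ' : quad (gram r θ x) ζ = 1 := hζ
    rw [quad_gram hM] at hζ'
    -- a point of the `Q`-sphere stands for a vector of norm two in the span of the `f_1(x_i, ·)`
    obtain ⟨z, hz⟩ := hM.exists_evalE01_eq (g := ∑ i, ζ i • hM.evalE01 (x i)) (by
      nlinarith [norm_nonneg (∑ i, ζ i • hM.evalE01 (x i))])
    refine ⟨z, Set.mem_univ z, funext fun i => ?_⟩
    simp only [hφ, hz]
    exact inner_sum_smul_of_dual hdual ζ i
  · intro y z
    have h1 : ∑ i, ((fun i => φ i y) - fun i => φ i z) i • hM.evalE01 (x i) =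
        hM.evalE01 y - hM.evalE01 z := by
      rw [← hsum y, ← hsum z, ← Finset.sum_sub_distrib]
      exact Finset.sum_congr rfl fun i _ => sub_smul _ _ _
    have h2 : quad (gram r θ x) ((fun i => φ i y) - fun i => φ i z) =
        2 - 2 * (Real.cos (r y z) * Real.cos (θ y z)) := by
      rw [quad_gram hM, h1, norm_sub_sq_real, hM.inner_evalE01, hM.norm_evalE01, hM.norm_evalE01]
      ring
    rw [sphereDist, h2, delta]
    exact two_mul_arcsin_eq_arccos (abs_le.1 (hu y z)).1 (abs_le.1 (hu y z)).2

end

end HopfHeat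

theorem mainTheorem2 {M : Type*} [Nonempty M] [TopologicalSpace M] [MeasurableSpace M]
    [BorelSpace M] (r θ : M → M → ℝ) (μ : MeasureTheory.Measure M)
    [MeasureTheory.SigmaFinite μ] [μ.IsOpenPosMeasure]
    (hM : HopfHeat.IsHopfHeatSpace r θ μ) :
    HopfHeat.IsMetric (HopfHeat.delta r θ) ∧
    Module.finrank ℝ (HopfHeat.E01 r θ μ) = 4 ∧
    (∃ (x : Fin 4 → M) (φ : Fin 4 → M → ℝ), HopfHeat.IsDualEigenbasis r θ μ x φ) ∧
    ∀ (x : Fin 4 → M) (φ : Fin 4 → M → ℝ), HopfHeat.IsDualEigenbasis r θ μ x φ →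
      (HopfHeat.gram r θ x).PosDef ∧
      Set.BijOn (fun y i => φ i y) Set.univ (HopfHeat.sphere3 (HopfHeat.gram r θ x)) ∧
      ∀ y z : M, HopfHeat.sphereDist (HopfHeat.gram r θ x) (fun i => φ i y) (fun i => φ i z) =
        HopfHeat.delta r θ y z := by
  have hfin := hM.isFiniteMeasure
  have hprob := hM.isProbabilityMeasure
  exact ⟨hM.isMetric_delta, hM.finrank_E01, hM.exists_isDualEigenbasis,
    fun x φ hx => HopfHeat.isometry_of_isDualEigenbasis hM hx⟩
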